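/- Let $G$ be a finite, simple, undirected, connected graph with maximum degree $\Delta$, and suppose that $G$ is $3$-sparse, i.e. every edge of $G$ has at least one endpoint of degree at most $3$. An acyclic edge coloring of $G$ is a proper edge coloring in which no cycle has its edges colored with exactly two colors, and the acyclic chromatic index $a'(G)$ is the minimum number of colors in an acyclic edge coloring of $G$. If $G$ has an edge $xy$ with $d_G(x)+d_G(y) < \Delta+3$, where $d_G$ denotes the degree in $G$, then $G$ has an acyclic edge coloring with at most $\Delta+1$ colors; that is, $a'(G) \le \Delta+1$. -/

import Mathlib

namespace SimpleGraph

/-- A locally finite graph is `k`-sparse if every edge has an endpoint of degree at most `k`. -/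
def IsSparse {V : Type*} (G : SimpleGraph V) [G.LocallyFinite] (k : ℕ) : Prop :=
  ∀ ⦃u v : V⦄, G.Adj u v → G.degree u ≤ k ∨ G.degree v ≤ k

/-- A proper edge coloring of `G` with colors in `α` is a proper vertex coloring of the line graph
of `G`: distinct edges that share an endpoint receive distinct colors. -/
abbrev ProperEdgeColoring {V : Type*} (G : SimpleGraph V) (α : Type*) : Type _ :=
  G.lineGraph.Coloring α

/-- The edges of the walk `p` are colored with exactly two colors. -/
def ProperEdgeColoring.IsBichromatic {V : Type*} {G : SimpleGraph V} {α : Type*}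
    (c : G.ProperEdgeColoring α) {u v : V} (p : G.Walk u v) : Prop :=
  {a : α | ∃ e : G.edgeSet, (e : Sym2 V) ∈ p.edges ∧ c e = a}.ncard = 2

/-- A proper edge coloring is acyclic if there is no bichromatic cycle. -/
def ProperEdgeColoring.IsAcyclic {V : Type*} {G : SimpleGraph V} {α : Type*}
    (c : G.ProperEdgeColoring α) : Prop :=
  ∀ (v : V) (p : G.Walk v v), p.IsCycle → ¬ c.IsBichromatic p

/-- `G` has an acyclic edge coloring with (at most) `k` colors. -/
def AcyclicEdgeColorable {V : Type*} (G : SimpleGraph V) (k : ℕ) : Prop :=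
  ∃ c : G.ProperEdgeColoring (Fin k), c.IsAcyclic

/-- The acyclic chromatic index `a'(G)`: the least number of colors in an acyclic edge coloring
of `G`. It is `⊤` if there is no such coloring with finitely many colors, which does not happen
for finite graphs. -/
noncomputable def acyclicChromaticIndex {V : Type*} (G : SimpleGraph V) : ℕ∞ :=
  ⨅ k ∈ {k : ℕ | G.AcyclicEdgeColorable k}, (k : ℕ∞)

end SimpleGraph

/-! The proof is an induction over subgraphs. Connectedness is not inherited by subgraphs, so the
induction runs over the class `IsReducible`, which asks every nonempty subgraph to have a light
edge, one with degree sum at most `Δ + 2`. In a connected sparse graph a single light edge suffices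
(`Connected.isReducible`): all degree sums along edges are at most `Δ + 3`, so a subgraph without
light edges keeps all edges at each vertex that it touches and is the whole graph.

Two color classes of an acyclic edge coloring form disjoint paths, so no bichromatic component has
three ends. If a partial coloring does not extend, there are bichromatic paths from some vertex `a`,
for many pairs of colors. They force certain neighbors of `a` of small degree to have only colors
missing at `a` on their other edges. Exchanging the colors of two edges from `a` to such neighbors
is then harmless (`IsExchange.valid`) and breaks one of the paths (`IsExchange.not_reachable`). This
contradiction is used again and again.

A vertex of degree 1 or 2 can be deleted, and its edges colored afterwards, in degree 2 possibly
after an exchange. A vertex of degree at least 4 and less than `Δ` can be deleted as well: its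
neighbors have degree at most 3, and its edges are colored by the purely combinatorial
`exists_isStarColoring`. In the remaining case every degree is 0, 3 or `Δ`, so a light edge `x y`
joins two vertices of degree 3.

For this edge, a coloring of `G` without `x y` is given. It is kept away from `x` and `y`, and all
five edges at `x` and `y` are recolored. `IsLink.isBlocked` turns failure of all recolorings into a
statement about missing colors and bichromatic paths at the outer neighbors `a`, `b` of `x` and `u`,
`v` of `y`. That statement determines the missing colors almost completely and produces the paths
needed for an exchange at `a`, after which a recoloring succeeds. The cases of distinct and of
common outer neighbors are `IsLink.false_of_distinct` and `IsLink.false_of_common`. -/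

namespace SimpleGraph

variable {V C : Type*}

/-! ### Ends, reachability and acyclicity around a single vertex -/

/-- A vertex is an end of `H` if it has at most one neighbor. -/
def IsEnd (H : SimpleGraph V) (v : V) : Prop :=
  ∀ ⦃s t⦄, H.Adj v s → H.Adj v t → s = t

/-- Every vertex of `H` has at most two neighbors. -/
def IsLinear (H : SimpleGraph V) : Prop :=
  ∀ ⦃v r s t⦄, H.Adj v r → H.Adj v s → H.Adj v t → r = s ∨ r = t ∨ s = t

/-- The graph `G` with all edges at `x` removed. -/
def isolate (G : SimpleGraph V) (x : V) : SimpleGraph V where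
  Adj u v := G.Adj u v ∧ u ≠ x ∧ v ≠ x
  symm := ⟨fun _ _ h => ⟨h.1.symm, h.2.2, h.2.1⟩⟩
  loopless := ⟨fun _ h => h.1.ne rfl⟩

theorem isolate_adj {G : SimpleGraph V} {x u v : V} :
    (G.isolate x).Adj u v ↔ G.Adj u v ∧ u ≠ x ∧ v ≠ x := Iff.rfl

theorem isolate_le (G : SimpleGraph V) (x : V) : G.isolate x ≤ G := fun _ _ h => h.1

/-- The edges of `G` that have color `α` or `β`. -/
def twoColored (G : SimpleGraph V) (c : Sym2 V → C) (α β : C) : SimpleGraph V where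
  Adj u v := G.Adj u v ∧ (c s(u, v) = α ∨ c s(u, v) = β)
  symm := ⟨fun u v h => ⟨h.1.symm, by rw [Sym2.eq_swap]; exact h.2⟩⟩
  loopless := ⟨fun _ h => h.1.ne rfl⟩

theorem twoColored_adj {G : SimpleGraph V} {c : Sym2 V → C} {α β : C} {u v : V} :
    (G.twoColored c α β).Adj u v ↔ G.Adj u v ∧ (c s(u, v) = α ∨ c s(u, v) = β) := Iff.rfl

theorem twoColored_comm (G : SimpleGraph V) (c : Sym2 V → C) (α β : C) :
    G.twoColored c α β = G.twoColored c β α := by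
  ext u v; simp [twoColored_adj, or_comm]

/-- The color `α` appears at the vertex `v`. -/
def Sees (G : SimpleGraph V) (c : Sym2 V → C) (v : V) (α : C) : Prop :=
  ∃ w, G.Adj v w ∧ c s(v, w) = α

/-- `c` restricts to an acyclic edge coloring of `G`. -/
structure Valid (G : SimpleGraph V) (c : Sym2 V → C) : Prop where
  proper : ∀ ⦃u v w⦄, G.Adj u v → G.Adj u w → c s(u, v) = c s(u, w) → v = w
  acyclic : ∀ ⦃α β⦄, α ≠ β → (G.twoColored c α β).IsAcyclic

theorem Valid.mono {G G' : SimpleGraph V} {c : Sym2 V → C} (h : G.Valid c) (hle : G' ≤ G) :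
    G'.Valid c where
  proper _ _ _ h₁ h₂ := h.proper (hle h₁) (hle h₂)
  acyclic α β hαβ := (h.acyclic hαβ).anti fun u v (h' : (G'.twoColored c α β).Adj u v) =>
    show (G.twoColored c α β).Adj u v from ⟨hle h'.1, h'.2⟩

/-- Removing a vertex `x` whose only neighbors are `a` and `b` cuts walks into pieces. -/
theorem reachable_of_neighbors {H' H : SimpleGraph V} {x a b z w : V}
    (hx : ∀ n, H'.Adj x n → n = a ∨ n = b)
    (hle : ∀ s t, s ≠ x → t ≠ x → H'.Adj s t → H.Adj s t)
    (hz : z ≠ x) (hw : w ≠ x) (h : H'.Reachable z w) :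
    H.Reachable z w ∨ (H.Reachable z a ∧ H.Reachable b w) ∨
      (H.Reachable z b ∧ H.Reachable a w) := by
  have key : ∀ t, Relation.ReflTransGen H'.Adj z t →
      (t ≠ x → H.Reachable z t ∨ (H.Reachable z a ∧ H.Reachable b t) ∨
        (H.Reachable z b ∧ H.Reachable a t)) ∧
      (t = x → H.Reachable z a ∨ H.Reachable z b) := by
    intro t ht
    induction ht with
    | refl => exact ⟨fun _ => Or.inl (Reachable.refl _), fun h => absurd h hz⟩
    | @tail s t _ hst ih =>
      refine ⟨fun htx => ?_, fun htx => ?_⟩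
      · by_cases hsx : s = x
        · subst hsx
          have h1 := ih.2 rfl
          rcases hx t hst with rfl | rfl
          · rcases h1 with h1 | h1
            · exact Or.inl h1
            · exact Or.inr (Or.inr ⟨h1, Reachable.refl _⟩)
          · rcases h1 with h1 | h1
            · exact Or.inr (Or.inl ⟨h1, Reachable.refl _⟩)
            · exact Or.inl h1
        · have hadj := (hle s t hsx htx hst).reachable
          rcases ih.1 hsx with h1 | ⟨h1, h2⟩ | ⟨h1, h2⟩
          · exact Or.inl (h1.trans hadj)
          · exact Or.inr (Or.inl ⟨h1, h2.trans hadj⟩)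
          · exact Or.inr (Or.inr ⟨h1, h2.trans hadj⟩)
      · subst htx
        have hsx : s ≠ t := hst.ne
        rcases ih.1 hsx with h1 | ⟨h1, _⟩ | ⟨h1, _⟩
        · rcases hx s hst.symm with rfl | rfl
          · exact Or.inl h1
          · exact Or.inr h1
        · exact Or.inl h1
        · exact Or.inr h1
  exact (key w ((reachable_iff_reflTransGen _ _).1 h)).1 hw

theorem IsEnd.reachable {H' H : SimpleGraph V} {x z w : V} (hx : H'.IsEnd x)
    (hle : ∀ s t, s ≠ x → t ≠ x → H'.Adj s t → H.Adj s t)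
    (hz : z ≠ x) (hw : w ≠ x) (h : H'.Reachable z w) : H.Reachable z w := by
  by_cases hn : ∃ a, H'.Adj x a
  · obtain ⟨a, ha⟩ := hn
    rcases reachable_of_neighbors (a := a) (b := a) (fun n hn => Or.inl (hx hn ha)) hle hz hw h with
      h1 | ⟨h1, h2⟩ | ⟨h1, h2⟩
    exacts [h1, h1.trans h2, h1.trans h2]
  · push Not at hn
    rcases reachable_of_neighbors (a := z) (b := z) (fun n h' => absurd h' (hn n)) hle hz hw h with
      h1 | ⟨h1, h2⟩ | ⟨h1, h2⟩
    exacts [h1, h1.trans h2, h1.trans h2]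

theorem eq_of_reachable_of_forall_not_adj {H : SimpleGraph V} {x z : V} (hx : ∀ n, ¬ H.Adj x n)
    (h : H.Reachable x z) : x = z := by
  obtain ⟨p⟩ := h
  cases p with
  | nil => rfl
  | cons h _ => exact absurd h (hx _)

theorem exists_adj_of_reachable {H : SimpleGraph V} {x z : V} (hxz : x ≠ z)
    (h : H.Reachable x z) : ∃ n, H.Adj x n := by
  by_contra hn
  push Not at hn
  exact hxz (eq_of_reachable_of_forall_not_adj hn h)

/-- A neighbor of an end which is not itself the target of a walk has a second neighbor. -/
theorem IsEnd.exists_second_adj {H : SimpleGraph V} {x n z : V} (hx : H.IsEnd x) (hn : H.Adj x n)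
    (hxz : x ≠ z) (hnz : n ≠ z) (h : H.Reachable x z) : ∃ m, H.Adj n m ∧ m ≠ x := by
  by_contra hm
  push Not at hm
  have key : ∀ t, Relation.ReflTransGen H.Adj x t → t = x ∨ t = n := by
    intro t ht
    induction ht with
    | refl => exact Or.inl rfl
    | tail _ hst ih =>
      rcases ih with rfl | rfl
      · exact Or.inr (hx hst hn)
      · exact Or.inl (hm _ hst)
  rcases key z ((reachable_iff_reflTransGen _ _).1 h) with h | h
  exacts [hxz h.symm, hnz h.symm]

/-- Adding the edges `x a` and `x b` one at a time joins different components each time, so no cycle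
can arise. -/
theorem isAcyclic_of_neighbors {H' H : SimpleGraph V} {x a b : V}
    (hx : ∀ n, H'.Adj x n → n = a ∨ n = b)
    (hle : ∀ s t, s ≠ x → t ≠ x → H'.Adj s t → H.Adj s t) (hH : H.IsAcyclic)
    (hiso : ∀ n, ¬ H.Adj x n) (ha : a ≠ x) (hb : b ≠ x) (hab : a ≠ b → ¬ H.Reachable a b) :
    H'.IsAcyclic := by
  have h1 : (H ⊔ edge x a).IsAcyclic :=
    hH.sup_edge_of_not_reachable fun h => ha (eq_of_reachable_of_forall_not_adj hiso h).symm
  have h2 : (H ⊔ edge x a ⊔ edge x b).IsAcyclic := by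
    by_cases hab' : a = b
    · subst hab'
      rwa [sup_edge_of_adj]
      exact Or.inr (by simp [edge_adj, ha.symm])
    · refine h1.sup_edge_of_not_reachable fun h => hab hab' ?_
      have hax : (H ⊔ edge x a).Adj a x := Or.inr (by simp [edge_adj, ha])
      have h3 : (H ⊔ edge x a).Reachable a b := hax.reachable.trans h
      refine IsEnd.reachable (x := x) ?_ ?_ ha hb h3
      · intro s t hs ht
        have : ∀ s, (H ⊔ edge x a).Adj x s → s = a := by
          rintro s (hs | hs)
          · exact absurd hs (hiso s)
          · rw [edge_adj] at hs
            rcases hs.1 with h | h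
            · exact h.2
            · exact absurd h.1 ha.symm
        rw [this s hs, this t ht]
      · rintro s t hs ht (h | h)
        · exact h
        · rw [edge_adj] at h
          rcases h.1 with h | h
          · exact absurd h.1 hs
          · exact absurd h.2 ht
  refine h2.anti fun s t hst => ?_
  by_cases hs : s = x
  · subst hs
    rcases hx t hst with rfl | rfl
    · exact Or.inl (Or.inr (by simp [edge_adj, hst.ne]))
    · exact Or.inr (by simp [edge_adj, hst.ne])
  · by_cases ht : t = x
    · subst ht
      rcases hx s hst.symm with rfl | rfl
      · exact Or.inl (Or.inr (by simp [edge_adj, hs]))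
      · exact Or.inr (by simp [edge_adj, hs])
    · exact Or.inl (Or.inl (hle s t hs ht hst))

theorem IsEnd.isAcyclic {H' H : SimpleGraph V} {x : V} (hx : H'.IsEnd x)
    (hle : ∀ s t, s ≠ x → t ≠ x → H'.Adj s t → H.Adj s t) (hH : H.IsAcyclic) :
    H'.IsAcyclic := by
  -- `x` need not be isolated in `H`, so its edges are removed before the single edge of `H'` is put
  -- back.
  have hle' : ∀ s t, s ≠ x → t ≠ x → H'.Adj s t → (H.isolate x).Adj s t :=
    fun s t hs ht h => ⟨hle s t hs ht h, hs, ht⟩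
  by_cases hn : ∃ a, H'.Adj x a
  · obtain ⟨a, ha⟩ := hn
    exact isAcyclic_of_neighbors (a := a) (b := a) (fun n hn => Or.inl (hx hn ha)) hle'
      (hH.anti (isolate_le _ _)) (fun n h => h.2.1 rfl) ha.ne.symm ha.ne.symm
      (fun h => absurd rfl h)
  · push Not at hn
    refine hH.anti fun s t hst => hle s t ?_ ?_ hst
    · rintro rfl; exact hn _ hst
    · rintro rfl; exact hn _ hst.symm

/-- Both paths leave `z` away from `s`, so with at most two neighbors available they take the same
step. They stay together until one of them stops at an end, where the other cannot continue. -/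
theorem IsLinear.eq_of_isPath {H : SimpleGraph V} (hH : H.IsLinear) {w t : V} (hw : H.IsEnd w)
    (ht : H.IsEnd t) : ∀ {z : V} (p : H.Walk z w) (q : H.Walk z t) (s : V), H.Adj z s →
      p.IsPath → q.IsPath → s ∉ p.support → s ∉ q.support → w = t := by
  intro z p
  induction p with
  | nil =>
    intro q s hs _ _ _ hsq
    cases q with
    | nil => rfl
    | cons h q =>
      rw [hw hs h] at hsq
      simp at hsq
  | @cons z n w h p ih =>
    intro q s hs hp hq hsp hsq
    cases q with
    | nil =>
      rw [ht hs h] at hsp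
      simp at hsp
    | @cons _ m _ h' q =>
      have hnm : n = m := by
        rcases hH hs h h' with e | e | e
        · rw [e] at hsp; simp at hsp
        · rw [e] at hsq; simp at hsq
        · exact e
      subst hnm
      rw [Walk.cons_isPath_iff] at hp hq
      exact ih hw q z h.symm hp.1 hq.1 hp.2 hq.2

/-- A component of a graph with maximum degree two has at most two ends. -/
theorem IsLinear.eq_of_isEnd {H : SimpleGraph V} (hH : H.IsLinear) {z w t : V} (hz : H.IsEnd z)
    (hw : H.IsEnd w) (ht : H.IsEnd t) (hzw : z ≠ w) (hzt : z ≠ t) (h₁ : H.Reachable z w)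
    (h₂ : H.Reachable z t) : w = t := by
  classical
  obtain ⟨p, hp⟩ := h₁.exists_isPath
  obtain ⟨q, hq⟩ := h₂.exists_isPath
  cases p with
  | nil => exact absurd rfl hzw
  | cons h p =>
    cases q with
    | nil => exact absurd rfl hzt
    | cons h' q =>
      have := hz h h'
      subst this
      rw [Walk.cons_isPath_iff] at hp hq
      exact hH.eq_of_isPath hw ht p q z h.symm hp.1 hq.1 hp.2 hq.2

/-! ### Bichromatic components and extension of a coloring at a vertex -/

section Colorings

variable {G : SimpleGraph V} {c : Sym2 V → C}

theorem Valid.isLinear (h : G.Valid c) (α β : C) : (G.twoColored c α β).IsLinear := by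
  rintro v r s t ⟨hr, hr'⟩ ⟨hs, hs'⟩ ⟨ht, ht'⟩
  have h1 := h.proper hr hs
  have h2 := h.proper hr ht
  have h3 := h.proper hs ht
  rcases hr' with hr' | hr' <;> rcases hs' with hs' | hs' <;> rcases ht' with ht' | ht' <;>
    simp_all

theorem Valid.isEnd_left (h : G.Valid c) {v : V} {α : C} (hα : ¬ G.Sees c v α) (β : C) :
    (G.twoColored c α β).IsEnd v := by
  rintro s t ⟨hs, hs'⟩ ⟨ht, ht'⟩
  have hs'' := hs'.resolve_left fun e => hα ⟨s, hs, e⟩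
  have ht'' := ht'.resolve_left fun e => hα ⟨t, ht, e⟩
  exact h.proper hs ht (hs''.trans ht''.symm)

theorem Valid.isEnd_right (h : G.Valid c) {v : V} {β : C} (hβ : ¬ G.Sees c v β) (α : C) :
    (G.twoColored c α β).IsEnd v := by
  rw [twoColored_comm]; exact h.isEnd_left hβ α

theorem not_reachable_of_not_sees {α β : C} {z w : V} (hα : ¬ G.Sees c z α)
    (hβ : ¬ G.Sees c z β) (hzw : z ≠ w) : ¬ (G.twoColored c α β).Reachable z w := by
  intro h
  obtain ⟨n, hn, hn' | hn'⟩ := exists_adj_of_reachable hzw h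
  · exact hα ⟨n, hn, hn'⟩
  · exact hβ ⟨n, hn, hn'⟩

/-- Extending an acyclic edge coloring to the edges at one vertex. -/
theorem Valid.extend {x : V} (h : (G.isolate x).Valid c) (col : V → C)
    (hinj : ∀ ⦃v w⦄, G.Adj x v → G.Adj x w → col v = col w → v = w)
    (hsees : ∀ v, G.Adj x v → ¬ (G.isolate x).Sees c v (col v))
    (hreach : ∀ v w, G.Adj x v → G.Adj x w → v ≠ w →
      ¬ ((G.isolate x).twoColored c (col v) (col w)).Reachable v w) :
    ∃ c' : Sym2 V → C, G.Valid c' ∧ (∀ u v, u ≠ x → v ≠ x → c' s(u, v) = c s(u, v)) ∧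
      ∀ v, c' s(x, v) = col v := by
  classical
  let c' : Sym2 V → C := fun e => if h : ∃ v, e = s(x, v) then col h.choose else c e
  have hx : ∀ v, c' s(x, v) = col v := by
    intro v
    have he : ∃ w, s(x, v) = s(x, w) := ⟨v, rfl⟩
    have : c' s(x, v) = col he.choose := dif_pos he
    rw [this, ← Sym2.congr_right.1 he.choose_spec]
  have hc : ∀ u v, u ≠ x → v ≠ x → c' s(u, v) = c s(u, v) := by
    intro u v hu hv
    refine dif_neg ?_
    rintro ⟨w, hw⟩
    rcases Sym2.eq_iff.1 hw with ⟨h, _⟩ | ⟨_, h⟩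
    exacts [hu h, hv h]
  refine ⟨c', ⟨?_, ?_⟩, hc, hx⟩
  · intro u v w huv huw he
    by_cases hu : u = x
    · subst hu
      rw [hx, hx] at he
      exact hinj huv huw he
    by_cases hv : v = x
    · subst hv
      by_cases hw : w = v
      · exact hw.symm
      · rw [Sym2.eq_swap, hx, hc u w hu hw] at he
        exact absurd ⟨w, ⟨huw, hu, hw⟩, he.symm⟩ (hsees u huv.symm)
    · by_cases hw : w = x
      · subst hw
        rw [Sym2.eq_swap (a := u) (b := w), hx, hc u v hu hv] at he
        exact absurd ⟨v, ⟨huv, hu, hv⟩, he⟩ (hsees u huw.symm)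
      · rw [hc u v hu hv, hc u w hu hw] at he
        exact h.proper ⟨huv, hu, hv⟩ ⟨huw, hu, hw⟩ he
  · intro α β hαβ
    have hle : ∀ s t, s ≠ x → t ≠ x → (G.twoColored c' α β).Adj s t →
        ((G.isolate x).twoColored c α β).Adj s t := by
      rintro s t hs ht ⟨h1, h2⟩
      rw [hc s t hs ht] at h2
      exact ⟨⟨h1, hs, ht⟩, h2⟩
    by_cases hend : (G.twoColored c' α β).IsEnd x
    · exact hend.isAcyclic hle (h.acyclic hαβ)
    -- Both colors occur at `x`. A cycle through `x` would need a bichromatic path between the two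
    -- neighbors, which `hreach` forbids.
    · simp only [IsEnd, not_forall] at hend
      obtain ⟨a, b, ha, hb, hab⟩ := hend
      have hA := ha.2
      have hB := hb.2
      rw [hx] at hA hB
      have hne : col a ≠ col b := fun e => hab (hinj ha.1 hb.1 e)
      refine isAcyclic_of_neighbors (a := a) (b := b) ?_ hle (h.acyclic hαβ)
        (fun n hn => hn.1.2.1 rfl) ha.1.ne.symm hb.1.ne.symm ?_
      · rintro n ⟨hn, hn'⟩
        rw [hx] at hn'
        have h1 := hinj hn ha.1
        have h2 := hinj hn hb.1
        rcases hA with hA | hA <;> rcases hB with hB | hB <;> rcases hn' with hn' | hn' <;>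
          simp_all
      · intro _
        have := hreach a b ha.1 hb.1 hab
        rcases hA with hA | hA <;> rcases hB with hB | hB
        · exact absurd (hA.trans hB.symm) hne
        · rwa [hA, hB] at this
        · rwa [hA, hB, twoColored_comm] at this
        · exact absurd (hA.trans hB.symm) hne

/-- A bichromatic path from `a` to `b` avoiding `x` would close up through `x`. This is the converse
of the reachability condition in `Valid.extend`. -/
theorem Valid.not_reachable_isolate (h : G.Valid c) {x a b : V} (ha : G.Adj x a) (hb : G.Adj x b)
    (hab : a ≠ b) :
    ¬ ((G.isolate x).twoColored c (c s(x, a)) (c s(x, b))).Reachable a b := by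
  intro hr
  have hne : c s(x, a) ≠ c s(x, b) := fun e => hab (h.proper ha hb e)
  have hac := h.acyclic hne
  rw [isAcyclic_iff_forall_adj_isBridge] at hac
  have hxa : (G.twoColored c (c s(x, a)) (c s(x, b))).Adj x a := ⟨ha, Or.inl rfl⟩
  have hbr := hac hxa
  rw [isBridge_iff] at hbr
  apply hbr
  have hxb : ((G.twoColored c (c s(x, a)) (c s(x, b))).deleteEdges {s(x, a)}).Adj x b := by
    rw [deleteEdges_adj]
    refine ⟨⟨hb, Or.inr rfl⟩, ?_⟩
    intro h'
    exact hab (Sym2.congr_right.1 h').symm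
  refine hxb.reachable.trans (Reachable.mono ?_ hr).symm
  rintro s t ⟨⟨h1, h2, h3⟩, h4⟩
  rw [deleteEdges_adj]
  refine ⟨⟨h1, h4⟩, ?_⟩
  intro h'
  rcases Sym2.eq_iff.1 h' with ⟨h', _⟩ | ⟨_, h'⟩
  exacts [h2 h', h3 h']

/-! ### Exchanging the colors of two edges at a vertex -/

/-- The colorings before and after exchanging the colors of the edges `a v₁` and `a v₂`. -/
structure IsExchange (G : SimpleGraph V) (c c' : Sym2 V → C) (a v₁ v₂ : V) : Prop where
  adj₁ : G.Adj a v₁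
  adj₂ : G.Adj a v₂
  ne : v₁ ≠ v₂
  pure₁ : ∀ t, G.Adj v₁ t → t ≠ a → ¬ G.Sees c a (c s(v₁, t))
  pure₂ : ∀ t, G.Adj v₂ t → t ≠ a → ¬ G.Sees c a (c s(v₂, t))
  eq₁ : c' s(a, v₁) = c s(a, v₂)
  eq₂ : c' s(a, v₂) = c s(a, v₁)
  eq_of_ne : ∀ e, e ≠ s(a, v₁) → e ≠ s(a, v₂) → c' e = c e

theorem exists_isExchange {a v₁ v₂ : V} (adj₁ : G.Adj a v₁) (adj₂ : G.Adj a v₂) (ne : v₁ ≠ v₂)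
    (pure₁ : ∀ t, G.Adj v₁ t → t ≠ a → ¬ G.Sees c a (c s(v₁, t)))
    (pure₂ : ∀ t, G.Adj v₂ t → t ≠ a → ¬ G.Sees c a (c s(v₂, t))) :
    ∃ c', G.IsExchange c c' a v₁ v₂ := by
  classical
  have hne : s(a, v₂) ≠ s(a, v₁) := fun h => ne (Sym2.congr_right.1 h).symm
  refine ⟨fun e => if e = s(a, v₁) then c s(a, v₂) else if e = s(a, v₂) then c s(a, v₁) else c e,
    adj₁, adj₂, ne, pure₁, pure₂, by simp, by simp [hne], fun e h1 h2 => by simp [h1, h2]⟩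

namespace IsExchange

variable {c' : Sym2 V → C} {a v₁ v₂ : V}

theorem symm' (h : G.IsExchange c c' a v₁ v₂) : G.IsExchange c c' a v₂ v₁ :=
  ⟨h.adj₂, h.adj₁, h.ne.symm, h.pure₂, h.pure₁, h.eq₂, h.eq₁, fun e h1 h2 => h.eq_of_ne e h2 h1⟩

theorem eq_of_ne_ne (h : G.IsExchange c c' a v₁ v₂) {s t : V} (hs : s ≠ a) (ht : t ≠ a) :
    c' s(s, t) = c s(s, t) := by
  refine h.eq_of_ne _ ?_ ?_ <;> intro h' <;> rcases Sym2.eq_iff.1 h' with ⟨h', _⟩ | ⟨_, h'⟩ <;>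
    contradiction

theorem eq_center (h : G.IsExchange c c' a v₁ v₂) {t : V} (h₁ : t ≠ v₁) (h₂ : t ≠ v₂) :
    c' s(a, t) = c s(a, t) :=
  h.eq_of_ne _ (fun e => h₁ (Sym2.congr_right.1 e)) (fun e => h₂ (Sym2.congr_right.1 e))

/-- Colors other than the exchanged ones stay where they are. -/
theorem color_iff (h : G.IsExchange c c' a v₁ v₂) {α : C} (h₁ : α ≠ c s(a, v₁))
    (h₂ : α ≠ c s(a, v₂)) (e : Sym2 V) : c' e = α ↔ c e = α := by
  by_cases e₁ : e = s(a, v₁)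
  · subst e₁; rw [h.eq₁]; exact ⟨fun e => absurd e.symm h₂, fun e => absurd e.symm h₁⟩
  by_cases e₂ : e = s(a, v₂)
  · subst e₂; rw [h.eq₂]; exact ⟨fun e => absurd e.symm h₁, fun e => absurd e.symm h₂⟩
  rw [h.eq_of_ne e e₁ e₂]

theorem sees_iff_of_color (h : G.IsExchange c c' a v₁ v₂) {α : C} (h₁ : α ≠ c s(a, v₁))
    (h₂ : α ≠ c s(a, v₂)) (v : V) : G.Sees c' v α ↔ G.Sees c v α := by
  simp only [Sees, h.color_iff h₁ h₂]

theorem twoColored_eq (h : G.IsExchange c c' a v₁ v₂) {α β : C} (h₁ : α ≠ c s(a, v₁))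
    (h₂ : α ≠ c s(a, v₂)) (h₃ : β ≠ c s(a, v₁)) (h₄ : β ≠ c s(a, v₂)) :
    G.twoColored c' α β = G.twoColored c α β := by
  ext s t
  simp only [twoColored_adj, h.color_iff h₁ h₂, h.color_iff h₃ h₄]

theorem sees_center (h : G.IsExchange c c' a v₁ v₂) (α : C) : G.Sees c' a α ↔ G.Sees c a α := by
  have key : ∀ {d d' : Sym2 V → C}, d' s(a, v₁) = d s(a, v₂) → d' s(a, v₂) = d s(a, v₁) →
      (∀ t, t ≠ v₁ → t ≠ v₂ → d' s(a, t) = d s(a, t)) → G.Sees d' a α → G.Sees d a α := by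
    rintro d d' h1 h2 h3 ⟨t, ht, ht'⟩
    by_cases e1 : t = v₁
    · subst e1; exact ⟨v₂, h.adj₂, h1 ▸ ht'⟩
    by_cases e2 : t = v₂
    · subst e2; exact ⟨v₁, h.adj₁, h2 ▸ ht'⟩
    exact ⟨t, ht, h3 t e1 e2 ▸ ht'⟩
  exact ⟨key h.eq₁ h.eq₂ fun t => h.eq_center,
    key h.eq₂.symm h.eq₁.symm fun t h1 h2 => (h.eq_center h1 h2).symm⟩

theorem sees_of_ne (h : G.IsExchange c c' a v₁ v₂) {v : V} (h₀ : v ≠ a) (h₁ : v ≠ v₁)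
    (h₂ : v ≠ v₂) (α : C) : G.Sees c' v α ↔ G.Sees c v α := by
  have : ∀ t, c' s(v, t) = c s(v, t) := by
    intro t
    refine h.eq_of_ne _ ?_ ?_ <;> intro h' <;> rcases Sym2.eq_iff.1 h' with ⟨h', _⟩ | ⟨h', _⟩ <;>
      contradiction
  simp only [Sees, this]

theorem color_ne (h : G.IsExchange c c' a v₁ v₂) (hc : G.Valid c) : c s(a, v₁) ≠ c s(a, v₂) :=
  fun e => h.ne (hc.proper h.adj₁ h.adj₂ e)

theorem not_sees₂ (h : G.IsExchange c c' a v₁ v₂) (hc : G.Valid c) :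
    ¬ G.Sees c v₂ (c s(a, v₁)) := by
  rintro ⟨t, ht, ht'⟩
  by_cases hta : t = a
  · subst hta
    rw [Sym2.eq_swap] at ht'
    exact h.color_ne hc ht'.symm
  · exact h.pure₂ t ht hta ⟨v₁, h.adj₁, ht'.symm⟩

/-- If `β` occurs at `a`, then purity leaves `v₂` with at most its edge to `a`. Otherwise `a` has at
most the edge to `v₂`. Either way one vertex is an end, and away from it the bichromatic graph is
contained in an old one. -/
theorem acyclic_aux (h : G.IsExchange c c' a v₁ v₂) (hc : G.Valid c) {β : C}
    (hβ : β ≠ c s(a, v₂)) (hβ' : c s(a, v₁) ≠ β) :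
    (G.twoColored c' (c s(a, v₁)) β).IsAcyclic := by
  have hcenter : ∀ n, (G.twoColored c' (c s(a, v₁)) β).Adj a n →
      n = v₂ ∨ (c s(a, n) = β ∧ G.Adj a n) := by
    rintro n ⟨hn, hn'⟩
    by_cases e2 : n = v₂
    · exact Or.inl e2
    by_cases e1 : n = v₁
    · subst e1
      rw [h.eq₁] at hn'
      rcases hn' with e | e
      · exact absurd e.symm (h.color_ne hc)
      · exact absurd e.symm hβ
    rw [h.eq_center e1 e2] at hn'
    rcases hn' with e | e
    · exact absurd (hc.proper hn h.adj₁ e) e1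
    · exact Or.inr ⟨e, hn⟩
  by_cases hs : G.Sees c a β
  · refine IsEnd.isAcyclic (x := v₂) ?_ ?_ (hc.acyclic hβ')
    · have : ∀ n, (G.twoColored c' (c s(a, v₁)) β).Adj v₂ n → n = a := by
        rintro n ⟨hn, hn'⟩
        by_contra hna
        rw [h.eq_of_ne_ne h.adj₂.ne.symm hna] at hn'
        rcases hn' with e | e
        · exact h.pure₂ n hn hna ⟨v₁, h.adj₁, e.symm⟩
        · exact h.pure₂ n hn hna (e ▸ hs)
      intro s t hs ht
      rw [this s hs, this t ht]
    · rintro s t hs ht ⟨h1, h2⟩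
      refine ⟨h1, ?_⟩
      by_cases e1 : s(s, t) = s(a, v₁)
      · rw [e1]; exact Or.inl rfl
      · rwa [h.eq_of_ne _ e1] at h2
        intro e2
        rcases Sym2.eq_iff.1 e2 with ⟨_, e⟩ | ⟨e, _⟩
        exacts [ht e, hs e]
  · refine IsEnd.isAcyclic (x := a) ?_ ?_ (hc.acyclic hβ')
    · intro s t hs' ht'
      have e1 := (hcenter s hs').resolve_right fun e => hs ⟨s, e.2, e.1⟩
      have e2 := (hcenter t ht').resolve_right fun e => hs ⟨t, e.2, e.1⟩
      rw [e1, e2]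
    · rintro s t hs ht ⟨h1, h2⟩
      rw [h.eq_of_ne_ne hs ht] at h2
      exact ⟨h1, h2⟩

/-- Colors on the other edges at `v₁` and `v₂` do not occur at `a`, so the exchange creates no
conflict there. If both exchanged colors are considered together, the bichromatic graph is
unchanged; `acyclic_aux` treats pairs with just one of them. -/
theorem valid (h : G.IsExchange c c' a v₁ v₂) (hc : G.Valid c) : G.Valid c' := by
  have hne := h.color_ne hc
  have hlocal : ∀ {w}, G.Adj a w → ∀ {t}, G.Adj w t → t ≠ a → c' s(a, w) ≠ c s(w, t) := by
    intro w hw t ht hta e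
    have hwt : c s(w, t) ≠ c s(a, w) := fun e' => hta
      (hc.proper ht hw.symm (e'.trans (by rw [Sym2.eq_swap])))
    by_cases e1 : w = v₁
    · subst e1; exact h.pure₁ t ht hta (e ▸ ⟨v₂, h.adj₂, h.eq₁.symm⟩)
    by_cases e2 : w = v₂
    · subst e2; exact h.pure₂ t ht hta (e ▸ ⟨v₁, h.adj₁, h.eq₂.symm⟩)
    rw [h.eq_center e1 e2] at e
    exact hwt e.symm
  refine ⟨?_, ?_⟩
  · intro u v w huv huw he
    by_cases hu : u = a
    · subst hu
      by_cases v1 : v = v₁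
      · subst v1
        by_cases w1 : w = v
        · exact w1.symm
        by_cases w2 : w = v₂
        · subst w2; rw [h.eq₁, h.eq₂] at he; exact absurd he.symm hne
        rw [h.eq₁, h.eq_center w1 w2] at he
        exact absurd (hc.proper h.adj₂ huw he).symm w2
      by_cases v2 : v = v₂
      · subst v2
        by_cases w1 : w = v₁
        · subst w1; rw [h.eq₁, h.eq₂] at he; exact absurd he hne
        by_cases w2 : w = v
        · exact w2.symm
        rw [h.eq₂, h.eq_center w1 w2] at he
        exact absurd (hc.proper h.adj₁ huw he).symm w1
      rw [h.eq_center v1 v2] at he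
      by_cases w1 : w = v₁
      · subst w1; rw [h.eq₁] at he; exact absurd (hc.proper huv h.adj₂ he) v2
      by_cases w2 : w = v₂
      · subst w2; rw [h.eq₂] at he; exact absurd (hc.proper huv h.adj₁ he) v1
      rw [h.eq_center w1 w2] at he
      exact hc.proper huv huw he
    · by_cases hv : v = a
      · subst hv
        by_cases hw : w = v
        · exact hw.symm
        rw [h.eq_of_ne_ne hu hw, Sym2.eq_swap] at he
        exact absurd he (hlocal huv.symm huw hw)
      · by_cases hw : w = a
        · subst hw
          rw [h.eq_of_ne_ne hu hv, Sym2.eq_swap (a := u) (b := w)] at he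
          exact absurd he.symm (hlocal huw.symm huv hv)
        rw [h.eq_of_ne_ne hu hv, h.eq_of_ne_ne hu hw] at he
        exact hc.proper huv huw he
  · intro α β hαβ
    by_cases α1 : α = c s(a, v₁)
    · by_cases β2 : β = c s(a, v₂)
      · refine (hc.acyclic hαβ).anti ?_
        rintro s t ⟨h1, h2⟩
        refine ⟨h1, ?_⟩
        subst α1 β2
        by_cases e1 : s(s, t) = s(a, v₁)
        · rw [e1]; exact Or.inl rfl
        by_cases e2 : s(s, t) = s(a, v₂)
        · rw [e2]; exact Or.inr rfl
        rwa [h.eq_of_ne _ e1 e2] at h2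
      · subst α1; exact h.acyclic_aux hc β2 hαβ
    by_cases α2 : α = c s(a, v₂)
    · by_cases β1 : β = c s(a, v₁)
      · refine (hc.acyclic hαβ).anti ?_
        rintro s t ⟨h1, h2⟩
        refine ⟨h1, ?_⟩
        subst α2 β1
        by_cases e1 : s(s, t) = s(a, v₁)
        · rw [e1]; exact Or.inr rfl
        by_cases e2 : s(s, t) = s(a, v₂)
        · rw [e2]; exact Or.inl rfl
        rwa [h.eq_of_ne _ e1 e2] at h2
      · subst α2; exact h.symm'.acyclic_aux hc β1 hαβ
    by_cases β1 : β = c s(a, v₁)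
    · subst β1; rw [twoColored_comm]; exact h.acyclic_aux hc α2 hαβ.symm
    by_cases β2 : β = c s(a, v₂)
    · subst β2; rw [twoColored_comm]; exact h.symm'.acyclic_aux hc α1 hαβ.symm
    rw [h.twoColored_eq α1 α2 β1 β2]
    exact hc.acyclic hαβ

theorem isEnd_center (h : G.IsExchange c c' a v₁ v₂) (hc : G.Valid c) {β : C}
    (hβ : ¬ G.Sees c a β) : (G.twoColored c' (c s(a, v₁)) β).IsEnd a :=
  (h.valid hc).isEnd_right (mt (h.sees_center β).1 hβ) _

/-- Walks avoiding the center are not changed by an exchange. -/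
theorem reachable_of_reachable (h : G.IsExchange c c' a v₁ v₂) (hc : G.Valid c) {β : C}
    (hβ : ¬ G.Sees c a β) {w w' : V} (hw : w ≠ a) (hw' : w' ≠ a)
    (hr : (G.twoColored c' (c s(a, v₁)) β).Reachable w w') :
    (G.twoColored c (c s(a, v₁)) β).Reachable w w' := by
  refine (h.isEnd_center hc hβ).reachable ?_ hw hw' hr
  rintro s t hs ht ⟨h1, h2⟩
  rw [h.eq_of_ne_ne hs ht] at h2
  exact ⟨h1, h2⟩

/-- An exchange breaks the bichromatic paths that use one of the exchanged edges. -/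
theorem not_reachable (h : G.IsExchange c c' a v₁ v₂) (hc : G.Valid c) {β : C}
    (hβ : ¬ G.Sees c a β) {w : V} (hwa : w ≠ a) (hw : w ≠ v₂)
    (hend : (G.twoColored c (c s(a, v₁)) β).IsEnd w)
    (hr : (G.twoColored c (c s(a, v₁)) β).Reachable a w) :
    ¬ (G.twoColored c' (c s(a, v₁)) β).Reachable a w := by
  intro hr'
  have hadj : (G.twoColored c' (c s(a, v₁)) β).Adj v₂ a := by
    refine ⟨h.adj₂.symm, Or.inl ?_⟩
    rw [Sym2.eq_swap, h.eq₂]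
  have h1 : (G.twoColored c (c s(a, v₁)) β).Reachable v₂ w :=
    h.reachable_of_reachable hc hβ h.adj₂.ne.symm hwa (hadj.reachable.trans hr')
  -- The old component of `w` would have three ends: `w`, `a`, and `v₂`, where the color of `a v₁`
  -- is missing.
  exact h.adj₂.ne ((hc.isLinear _ _).eq_of_isEnd hend (hc.isEnd_right hβ _)
    (hc.isEnd_left (h.not_sees₂ hc) _) hwa hw hr.symm h1.symm)

end IsExchange

end Colorings

/-! ### Star colorings: choosing colors for all edges at one vertex -/

/-- An injective choice of colors `col i ∈ D \ P i` for `i ∈ I` such that no two indices forbid the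
color chosen at the other one. -/
structure IsStarColoring {ι C : Type*} (P : ι → Finset C) (I : Finset ι) (D : Finset C)
    (col : ι → C) : Prop where
  inj : ∀ i ∈ I, ∀ j ∈ I, col i = col j → i = j
  mem : ∀ i ∈ I, col i ∈ D
  notMem : ∀ i ∈ I, col i ∉ P i
  not_mutual : ∀ i ∈ I, ∀ j ∈ I, col i ∈ P j → col j ∉ P i

section StarColoring

variable {ι C : Type*} [DecidableEq ι] [DecidableEq C] {P : ι → Finset C}

/-- A color forbidden at neither `i` nor `j` causes no mutual conflict between these two. If the
index `k` admits `δ` or `ε`, it takes that color and `i` takes the other one. Otherwise `P k` is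
exactly `{δ, ε}`, so no further color is forbidden at `k`. -/
theorem exists_isStarColoring_triple_of_two_free {i j k : ι} {D : Finset C} (hij : i ≠ j)
    (hik : i ≠ k) (hjk : j ≠ k) (hD : 5 ≤ D.card) (hi : (P i).card ≤ 2) (hj : (P j).card ≤ 2)
    (hk : (P k).card ≤ 2) {δ ε : C} (hδε : δ ≠ ε) (hδ : δ ∈ D) (hε : ε ∈ D) (hδi : δ ∉ P i)
    (hδj : δ ∉ P j) (hεi : ε ∉ P i) (hεj : ε ∉ P j) :
    ∃ col, IsStarColoring P {i, j, k} D col := by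
  suffices h : ∃ α ∈ D, ∃ β ∈ D, ∃ γ ∈ D, α ≠ β ∧ α ≠ γ ∧ β ≠ γ ∧ α ∉ P i ∧ β ∉ P j ∧ γ ∉ P k ∧
      ¬ (α ∈ P j ∧ β ∈ P i) ∧ ¬ (α ∈ P k ∧ γ ∈ P i) ∧ ¬ (β ∈ P k ∧ γ ∈ P j) by
    obtain ⟨α, hα, β, hβ, γ, hγ, h⟩ := h
    refine ⟨fun t => if t = i then α else if t = j then β else γ, ?_, ?_, ?_, ?_⟩ <;>
      simp only [Finset.mem_insert, Finset.mem_singleton] <;> grind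
  have free : ∀ {δ ε : C}, δ ≠ ε → δ ∈ D → ε ∈ D → δ ∉ P i → δ ∉ P j → ε ∉ P i → ε ∉ P j →
      δ ∉ P k → ∃ α ∈ D, ∃ β ∈ D, ∃ γ ∈ D, α ≠ β ∧ α ≠ γ ∧ β ≠ γ ∧ α ∉ P i ∧ β ∉ P j ∧ γ ∉ P k ∧
      ¬ (α ∈ P j ∧ β ∈ P i) ∧ ¬ (α ∈ P k ∧ γ ∈ P i) ∧ ¬ (β ∈ P k ∧ γ ∈ P j) := by
    intro δ ε hδε hδ hε hδi hδj hεi hεj hδk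
    have hcard : (insert δ (insert ε (P j))).card < D.card := by
      have h1 := Finset.card_insert_le δ (insert ε (P j))
      have h2 := Finset.card_insert_le ε (P j)
      omega
    obtain ⟨x, hx, hx'⟩ := Finset.exists_mem_notMem_of_card_lt_card hcard
    simp only [Finset.mem_insert, not_or] at hx'
    exact ⟨ε, hε, x, hx, δ, hδ, Ne.symm hx'.2.1, hδε.symm, hx'.1, hεi, hx'.2.2, hδk,
      fun h => hεj h.1, fun h => hδi h.2, fun h => hδj h.2⟩
  by_cases hδk : δ ∉ P k
  · exact free hδε hδ hε hδi hδj hεi hεj hδk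
  by_cases hεk : ε ∉ P k
  · exact free hδε.symm hε hδ hεi hεj hδi hδj hεk
  push Not at hδk hεk
  have hPk : P k = {δ, ε} := by
    symm
    apply Finset.eq_of_subset_of_card_le
    · intro x hx
      simp only [Finset.mem_insert, Finset.mem_singleton] at hx
      rcases hx with rfl | rfl <;> assumption
    · rw [Finset.card_pair hδε]; exact hk
  have hcard : (insert δ (insert ε (P i))).card < D.card := by
    have h1 := Finset.card_insert_le δ (insert ε (P i))
    have h2 := Finset.card_insert_le ε (P i)
    omega
  obtain ⟨x, hx, hx'⟩ := Finset.exists_mem_notMem_of_card_lt_card hcard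
  simp only [Finset.mem_insert, not_or] at hx'
  by_cases hxj : x ∈ P j
  · have hcard : (insert δ (insert ε (P j))).card < D.card := by
      have h1 := Finset.card_insert_le δ (insert ε (P j))
      have h2 := Finset.card_insert_le ε (P j)
      omega
    obtain ⟨y, hy, hy'⟩ := Finset.exists_mem_notMem_of_card_lt_card hcard
    simp only [Finset.mem_insert, not_or] at hy'
    refine ⟨δ, hδ, y, hy, x, hx, Ne.symm hy'.1, Ne.symm hx'.1, ?_, hδi, hy'.2.2, ?_,
      fun h => hδj h.1, fun h => hx'.2.2 h.2, ?_⟩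
    · rintro rfl; exact hy'.2.2 hxj
    · rw [hPk]; simp [hx'.1, hx'.2.1]
    · rw [hPk]; simp [hy'.1, hy'.2.1]
  · refine ⟨δ, hδ, ε, hε, x, hx, hδε, Ne.symm hx'.1, Ne.symm hx'.2.1, hδi, hεj, ?_,
      fun h => hδj h.1, fun h => hx'.2.2 h.2, fun h => hxj h.2⟩
    rw [hPk]; simp [hx'.1, hx'.2.1]

theorem exists_isStarColoring_triple {I : Finset ι} {D : Finset C} (hI : I.card = 3)
    (hD : 5 ≤ D.card) (hP : ∀ i ∈ I, (P i).card ≤ 2) : ∃ col, IsStarColoring P I D col := by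
  obtain ⟨i, j, k, hij, hik, hjk, rfl⟩ := Finset.card_eq_three.1 hI
  have hi := hP i (by simp)
  have hj := hP j (by simp)
  have hk := hP k (by simp)
  by_cases h : ∃ a b, a ∈ ({i, j, k} : Finset ι) ∧ b ∈ ({i, j, k} : Finset ι) ∧ a ≠ b ∧
      1 < (D \ (P a ∪ P b)).card
  · obtain ⟨a, b, ha, hb, hab, h⟩ := h
    obtain ⟨δ, ε, hδ, hε, hδε⟩ := Finset.one_lt_card_iff.1 h
    simp only [Finset.mem_sdiff, Finset.mem_union, not_or] at hδ hε
    obtain ⟨d, hd⟩ : ∃ d, ({i, j, k} : Finset ι) = {a, b, d} ∧ a ≠ d ∧ b ≠ d := by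
      simp only [Finset.mem_insert, Finset.mem_singleton] at ha hb
      rcases ha with rfl | rfl | rfl <;> rcases hb with rfl | rfl | rfl
      · exact absurd rfl hab
      · exact ⟨k, by grind, by grind, by grind⟩
      · exact ⟨j, by grind, by grind, by grind⟩
      · exact ⟨k, by grind, by grind, by grind⟩
      · exact absurd rfl hab
      · exact ⟨i, by grind, by grind, by grind⟩
      · exact ⟨j, by grind, by grind, by grind⟩
      · exact ⟨i, by grind, by grind, by grind⟩
      · exact absurd rfl hab
    rw [hd.1] at hP ⊢
    exact exists_isStarColoring_triple_of_two_free hab hd.2.1 hd.2.2 hD (hP a (by simp))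
      (hP b (by simp)) (hP d (by simp)) hδε hδ.1 hε.1 hδ.2.1 hδ.2.2 hε.2.1 hε.2.2
  -- Otherwise any two forbidden sets leave at most one color of `D`. With `5 ≤ D.card` this makes
  -- the three sets disjoint pairs inside `D`, and `D.card = 5` is too small for six colors.
  · exfalso
    push Not at h
    have key : ∀ a b, a ∈ ({i, j, k} : Finset ι) → b ∈ ({i, j, k} : Finset ι) → a ≠ b →
        D.card ≤ 5 ∧ ((D ∩ P a) ∩ (D ∩ P b)).card = 0 ∧ 2 ≤ (D ∩ P a).card := by
      intro a b ha hb hab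
      have h1 := h a b ha hb hab
      have h2 := Finset.card_sdiff_add_card_inter D (P a ∪ P b)
      rw [Finset.inter_union_distrib_left] at h2
      have h3 := Finset.card_union_add_card_inter (D ∩ P a) (D ∩ P b)
      have h4 := Finset.card_le_card (Finset.inter_subset_right : D ∩ P a ⊆ P a)
      have h5 := Finset.card_le_card (Finset.inter_subset_right : D ∩ P b ⊆ P b)
      have h6 := hP a ha
      have h7 := hP b hb
      omega
    obtain ⟨k1, k2, k3⟩ := key i j (by simp) (by simp) hij
    obtain ⟨-, k4, k5⟩ := key k i (by simp) (by simp) hik.symm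
    obtain ⟨-, k6, k7⟩ := key j k (by simp) (by simp) hjk
    have h1 := Finset.card_union_add_card_inter (D ∩ P i) (D ∩ P j)
    have h2 := Finset.card_union_add_card_inter (D ∩ P i ∪ D ∩ P j) (D ∩ P k)
    have h3 : ((D ∩ P i ∪ D ∩ P j) ∩ (D ∩ P k)) = ∅ := by
      rw [Finset.union_inter_distrib_right, Finset.card_eq_zero.1 k6, Finset.inter_comm,
        Finset.card_eq_zero.1 k4, Finset.union_empty]
    have h4 : (D ∩ P i ∪ D ∩ P j) ∪ (D ∩ P k) ⊆ D :=
      Finset.union_subset (Finset.union_subset Finset.inter_subset_left Finset.inter_subset_left)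
        Finset.inter_subset_left
    have h5 := Finset.card_le_card h4
    rw [h3, Finset.card_empty] at h2
    omega

/-- If there are at least three indices, each of which forbids at most two colors, and at least two
more colors than indices, then there is a star coloring. -/
theorem exists_isStarColoring (n : ℕ) : ∀ {I : Finset ι} {D : Finset C}, I.card = n + 3 →
    n + 5 ≤ D.card → (∀ i ∈ I, (P i).card ≤ 2) → ∃ col, IsStarColoring P I D col := by
  induction n with
  | zero => intro I D hI hD hP; exact exists_isStarColoring_triple hI hD hP
  | succ n ih =>
    intro I D hI hD hP
    -- Double counting: the sets `P i` contain at most `2 * I.card` elements in total, which is less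
    -- than `2 * D.card`.
    obtain ⟨α, hα, hocc⟩ : ∃ α ∈ D, (I.filter fun i => α ∈ P i).card ≤ 1 := by
      by_contra hcon
      push Not at hcon
      have h1 : D.card * 2 ≤ ∑ α ∈ D, (I.filter fun i => α ∈ P i).card := by
        rw [← smul_eq_mul]
        exact Finset.card_nsmul_le_sum _ _ _ fun α hα => hcon α hα
      have h2 : ∑ α ∈ D, (I.filter fun i => α ∈ P i).card =
          ∑ i ∈ I, (D.filter fun α => α ∈ P i).card := by
        simp only [Finset.card_filter]
        exact Finset.sum_comm
      have h3 : ∑ i ∈ I, (D.filter fun α => α ∈ P i).card ≤ I.card * 2 := by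
        rw [← smul_eq_mul]
        refine Finset.sum_le_card_nsmul _ _ _ fun i hi => (Finset.card_le_card ?_).trans (hP i hi)
        intro x hx
        exact (Finset.mem_filter.1 hx).2
      omega
    have step : ∀ j ∈ I, ∃ col, IsStarColoring P (I.erase j) (D.erase α) col := by
      intro j hj
      refine ih ?_ ?_ fun i hi => hP i (Finset.mem_of_mem_erase hi)
      · rw [Finset.card_erase_of_mem hj]; omega
      · rw [Finset.card_erase_of_mem hα]; omega
    by_cases hfree : ∀ i ∈ I, α ∉ P i
    · obtain ⟨e, he⟩ : I.Nonempty := Finset.card_pos.1 (by omega)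
      obtain ⟨col, h1, h2, h3, h4⟩ := step e he
      refine ⟨fun t => if t = e then α else col t, ?_, ?_, ?_, ?_⟩ <;>
        simp only [Finset.mem_erase] at h1 h2 h3 h4 <;> grind
    push Not at hfree
    obtain ⟨j, hj, hαj⟩ := hfree
    have huniq : ∀ i ∈ I, α ∈ P i → i = j := by
      intro i hi hαi
      exact Finset.card_le_one.1 hocc i (by simp [hi, hαi]) j (by simp [hj, hαj])
    obtain ⟨col, h1, h2, h3, h4⟩ := step j hj
    simp only [Finset.mem_erase] at h1 h2 h3 h4
    by_cases hsub : ∃ i ∈ I, i ≠ j ∧ (P j).erase α ⊆ P i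
    · obtain ⟨i, hi, hij, hsub⟩ := hsub
      have hsub' : ∀ x ∈ P j, x ≠ α → x ∈ P i := fun x hx hxα =>
        hsub (Finset.mem_erase.2 ⟨hxα, hx⟩)
      -- The index `j` inherits the color of `i`, and `i` receives `α`, which only `j` forbids.
      -- Since `P j` without `α` lies in `P i`, a conflict at `j` would already have been one at
      -- `i`.
      refine ⟨fun t => if t = i then α else if t = j then col i else col t, ?_, ?_, ?_, ?_⟩ <;>
        grind
    push Not at hsub
    obtain ⟨β, hβα, hPj⟩ : ∃ β, β ≠ α ∧ P j = {α, β} := by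
      have hcard : ((P j).erase α).card ≤ 1 := by
        rw [Finset.card_erase_of_mem hαj]; have := hP j hj; omega
      obtain ⟨i, hi⟩ : (I.erase j).Nonempty :=
        Finset.card_pos.1 (by rw [Finset.card_erase_of_mem hj]; omega)
      obtain ⟨β, hβ, -⟩ := Finset.not_subset.1
        (hsub i (Finset.mem_of_mem_erase hi) (Finset.ne_of_mem_erase hi))
      refine ⟨β, (Finset.mem_erase.1 hβ).1, ?_⟩
      ext x
      simp only [Finset.mem_insert, Finset.mem_singleton]
      refine ⟨fun hx => ?_, ?_⟩
      · by_cases hxα : x = α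
        · exact Or.inl hxα
        · exact Or.inr (Finset.card_le_one.1 hcard x (Finset.mem_erase.2 ⟨hxα, hx⟩) β hβ)
      · rintro (rfl | rfl)
        · exact hαj
        · exact (Finset.mem_erase.1 hβ).2
    obtain ⟨Q, hQ, hQP⟩ : ∃ Q : Finset C, Q.card ≤ 2 ∧
        ∀ k ∈ I, k ≠ j → col k = β → P k ⊆ Q := by
      by_cases hk : ∃ k ∈ I, k ≠ j ∧ col k = β
      · obtain ⟨k, hk, hkj, hkβ⟩ := hk
        refine ⟨P k, hP k hk, fun k' hk' hk'j hk'β => ?_⟩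
        rw [h1 k' ⟨hk'j, hk'⟩ k ⟨hkj, hk⟩ (hk'β.trans hkβ.symm)]
      · push Not at hk
        exact ⟨∅, by simp, fun k hk1 hk2 hk3 => absurd hk3 (hk k hk1 hk2)⟩
    -- The index `j` takes `δ`, and a previous owner of `δ` takes `α`. As `P j = {α, β}`, a mutual
    -- conflict with `j` could only involve that owner, which does not forbid `δ`, or the owner of
    -- `β`, which does not forbid `δ` by the choice of `Q`.
    obtain ⟨δ, hδ, hδ'⟩ : ∃ δ ∈ D, δ ∉ insert α (insert β Q) := by
      apply Finset.exists_mem_notMem_of_card_lt_card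
      have e1 := Finset.card_insert_le α (insert β Q)
      have e2 := Finset.card_insert_le β Q
      omega
    simp only [Finset.mem_insert, not_or] at hδ'
    obtain ⟨hδα, hδβ, hδQ⟩ := hδ'
    have hδk : ∀ k ∈ I, k ≠ j → col k = β → δ ∉ P k := fun k k1 k2 k3 h => hδQ (hQP k k1 k2 k3 h)
    refine ⟨fun t => if t = j then δ else if col t = δ then α else col t, ?_, ?_, ?_, ?_⟩
    · grind
    · grind
    · grind
    · intro s hs t ht
      by_cases hsj : s = j
      · subst hsj
        by_cases hts : t = s
        · grind
        · by_cases htδ : col t = δ <;> grind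
      · by_cases htj : t = j
        · subst htj
          by_cases hsδ : col s = δ <;> grind
        · by_cases hsδ : col s = δ <;> by_cases htδ : col t = δ <;> grind

end StarColoring

/-! ### Counting missing colors -/

section Missing

variable {V C : Type*}

/-- The number of neighbors of `v` in `G`. -/
noncomputable def numNeighbors (G : SimpleGraph V) (v : V) : ℕ :=
  (G.neighborSet v).ncard

open Classical in
/-- The colors that do not appear at `v`. -/
noncomputable def missing [Fintype C] (G : SimpleGraph V) (c : Sym2 V → C) (v : V) : Finset C :=
  Finset.univ.filter fun α => ¬ G.Sees c v α

theorem mem_missing [Fintype C] {G : SimpleGraph V} {c : Sym2 V → C} {v : V} {α : C} :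
    α ∈ G.missing c v ↔ ¬ G.Sees c v α := by
  simp [missing]

variable {G : SimpleGraph V} {c : Sym2 V → C}

theorem Valid.card_missing [Fintype C] (h : G.Valid c) (v : V) :
    (G.missing c v).card + G.numNeighbors v = Fintype.card C := by
  have h1 : {α | G.Sees c v α} = (fun w => c s(v, w)) '' G.neighborSet v := rfl
  have h2 : {α | G.Sees c v α}.ncard = G.numNeighbors v := by
    rw [h1]
    exact Set.InjOn.ncard_image fun s hs t ht e => h.proper hs ht e
  have h3 : (G.missing c v).card = ({α | G.Sees c v α}ᶜ).ncard := by
    rw [← Set.ncard_coe_finset]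
    congr 1
    ext α
    simp [missing]
  rw [h3, ← h2, ← Nat.card_eq_fintype_card, add_comm]
  exact Set.ncard_add_ncard_compl _

variable [Finite V]

theorem numNeighbors_isolate {x v : V} (h : G.Adj x v) :
    (G.isolate x).numNeighbors v + 1 = G.numNeighbors v := by
  have : (G.isolate x).neighborSet v = G.neighborSet v \ {x} := by
    ext w
    simp only [mem_neighborSet, isolate_adj, Set.mem_sdiff, Set.mem_singleton_iff]
    exact ⟨fun h => ⟨h.1, h.2.2⟩, fun h' => ⟨h'.1, h.ne.symm, h'.2⟩⟩
  rw [numNeighbors, this]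
  exact Set.ncard_sdiff_singleton_add_one h.symm

theorem numNeighbors_mono {G' : SimpleGraph V} (h : G' ≤ G) (v : V) :
    G'.numNeighbors v ≤ G.numNeighbors v :=
  Set.ncard_le_ncard fun _ hw => h hw

theorem numNeighbors_pos {u v : V} (h : G.Adj u v) : 0 < G.numNeighbors u :=
  (Set.ncard_pos).2 ⟨v, h⟩

/-- If the colors in `T` use up all edges at `v`, then no other color appears at `v`. -/
theorem mem_of_sees [DecidableEq C] {v : V} {T : Finset C} (hv : G.numNeighbors v ≤ T.card)
    (hT : ∀ α ∈ T, G.Sees c v α) {δ : C} (hδ : G.Sees c v δ) : δ ∈ T := by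
  have h1 : {α | G.Sees c v α} = (fun w => c s(v, w)) '' G.neighborSet v := rfl
  have hfin : {α | G.Sees c v α}.Finite := h1 ▸ Set.toFinite _
  have h2 : {α | G.Sees c v α}.ncard ≤ G.numNeighbors v :=
    h1 ▸ Set.ncard_image_le (Set.toFinite _)
  have h3 : (T : Set C) = {α | G.Sees c v α} := by
    refine Set.eq_of_subset_of_ncard_le (fun α hα => hT α hα) ?_ hfin
    rw [Set.ncard_coe_finset]
    exact h2.trans hv
  have : δ ∈ (T : Set C) := h3 ▸ hδ
  exact this

end Missing

/-! ### Vertices of degree 1, 2, and between 4 and `Δ - 1` -/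

section Reductions

variable {V : Type*} {G : SimpleGraph V} {Δ : ℕ}

/-- The graphs for which colorings with `Δ + 1` colors are constructed by induction. -/
structure IsReducible (G : SimpleGraph V) (Δ : ℕ) : Prop where
  le : ∀ v, G.numNeighbors v ≤ Δ
  sparse : ∀ u v, G.Adj u v → G.numNeighbors u ≤ 3 ∨ G.numNeighbors v ≤ 3
  exists_light : ∀ K ≤ G, K ≠ ⊥ → ∃ x y, K.Adj x y ∧ K.numNeighbors x + K.numNeighbors y ≤ Δ + 2

theorem IsReducible.add_le (h : G.IsReducible Δ) {u v : V} (huv : G.Adj u v) :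
    G.numNeighbors u + G.numNeighbors v ≤ Δ + 3 := by
  have h1 := h.le u
  have h2 := h.le v
  rcases h.sparse u v huv with h3 | h3 <;> omega

theorem exists_valid_of_pair {C : Type*} {c : Sym2 V → C} {x y z : V} (hc : (G.isolate x).Valid c)
    (hx : G.neighborSet x = {y, z}) (hyz : y ≠ z) {p q : C} (hpq : p ≠ q)
    (hp : ¬ (G.isolate x).Sees c y p) (hq : ¬ (G.isolate x).Sees c z q)
    (hr : ¬ ((G.isolate x).twoColored c p q).Reachable y z) :
    ∃ c' : Sym2 V → C, G.Valid c' ∧ (∀ u v, u ≠ x → v ≠ x → c' s(u, v) = c s(u, v)) ∧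
      c' s(x, y) = p ∧ c' s(x, z) = q := by
  classical
  have hadj : ∀ v, G.Adj x v ↔ v = y ∨ v = z := fun v => by rw [← mem_neighborSet, hx]; rfl
  have hzy : z ≠ y := hyz.symm
  obtain ⟨c', hc', h1, h2⟩ := hc.extend (fun v => if v = y then p else q) (by
      intro v w hv hw
      rcases (hadj v).1 hv with rfl | rfl <;> rcases (hadj w).1 hw with rfl | rfl <;>
        simp [hzy, hpq, hpq.symm]) (by
      intro v hv
      rcases (hadj v).1 hv with rfl | rfl <;> simpa [hzy]) (by
      intro v w hv hw hvw
      rcases (hadj v).1 hv with rfl | rfl <;> rcases (hadj w).1 hw with rfl | rfl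
      · exact absurd rfl hvw
      · simpa [hzy]
      · rw [twoColored_comm]
        simp only [hzy, if_true, if_false]
        exact fun h => hr h.symm
      · exact absurd rfl hvw)
  exact ⟨c', hc', h1, by rw [h2]; simp, by rw [h2]; simp [hzy]⟩

variable [Finite V]

theorem IsReducible.mono {K : SimpleGraph V} (h : G.IsReducible Δ) (hK : K ≤ G) :
    K.IsReducible Δ where
  le v := (numNeighbors_mono hK v).trans (h.le v)
  sparse u v huv := (h.sparse u v (hK huv)).imp (numNeighbors_mono hK u).trans
    (numNeighbors_mono hK v).trans
  exists_light _ hL := h.exists_light _ (hL.trans hK)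

theorem exists_valid_of_numNeighbors_eq_one (hG : ∀ v, G.numNeighbors v ≤ Δ) {x : V}
    (hx : G.numNeighbors x = 1) (ih : ∃ c : Sym2 V → Fin (Δ + 1), (G.isolate x).Valid c) :
    ∃ c : Sym2 V → Fin (Δ + 1), G.Valid c := by
  obtain ⟨c, hc⟩ := ih
  obtain ⟨y, hy⟩ := Set.ncard_eq_one.1 hx
  have hadj : ∀ v, G.Adj x v ↔ v = y := fun v => by rw [← mem_neighborSet, hy]; rfl
  have h1 := hc.card_missing y
  have h2 := numNeighbors_isolate ((hadj y).2 rfl)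
  have h3 := hG y
  rw [Fintype.card_fin] at h1
  obtain ⟨α, hα⟩ : ((G.isolate x).missing c y).Nonempty := Finset.card_pos.1 (by omega)
  obtain ⟨c', hc', -⟩ := hc.extend (fun _ => α)
    (fun v w hv hw _ => ((hadj v).1 hv).trans ((hadj w).1 hw).symm)
    (fun v hv => by rw [(hadj v).1 hv]; exact mem_missing.1 hα)
    (fun v w hv hw hvw => absurd (((hadj v).1 hv).trans ((hadj w).1 hw).symm) hvw)
  exact ⟨c', hc'⟩

/-- If no extension exists, any color missing at `y` and any different color missing at `z` form a
bichromatic path from `y` to `z`. These paths make two edges at `y`, with colors missing at `z`,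
exchangeable. The exchange destroys a path between `y` and `z`, and the extension succeeds. -/
theorem IsReducible.exists_valid_of_numNeighbors_eq_two (hG : G.IsReducible Δ) {x : V}
    (hx : G.numNeighbors x = 2) (ih : ∃ c : Sym2 V → Fin (Δ + 1), (G.isolate x).Valid c) :
    ∃ c : Sym2 V → Fin (Δ + 1), G.Valid c := by
  classical
  obtain ⟨c, hc⟩ := ih
  obtain ⟨y, z, hyz, hN⟩ := Set.ncard_eq_two.1 hx
  have hadj : ∀ v, G.Adj x v ↔ v = y ∨ v = z := fun v => by rw [← mem_neighborSet, hN]; rfl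
  by_contra hcon
  have hR : ∀ p q, p ≠ q → ¬ (G.isolate x).Sees c y p → ¬ (G.isolate x).Sees c z q →
      ((G.isolate x).twoColored c p q).Reachable y z := by
    intro p q hpq hp hq
    by_contra hr
    obtain ⟨c', hc', -⟩ := exists_valid_of_pair hc hN hyz hpq hp hq hr
    exact hcon ⟨c', hc'⟩
  have hy1 := hc.card_missing y
  have hz1 := hc.card_missing z
  have hy2 := numNeighbors_isolate ((hadj y).2 (Or.inl rfl))
  have hz2 := numNeighbors_isolate ((hadj z).2 (Or.inr rfl))
  have hy3 := hG.le y
  have hz3 := hG.le z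
  rw [Fintype.card_fin] at hy1 hz1
  -- If `δ` were missing at both vertices, then `y` would be isolated for `δ` and a second color `p`
  -- missing at `y`.
  have hdisj : ∀ δ, ¬ (G.isolate x).Sees c y δ → (G.isolate x).Sees c z δ := by
    intro δ hδy
    by_contra hδz
    obtain ⟨p, hp, hpδ⟩ := Finset.exists_mem_ne
      (show 1 < ((G.isolate x).missing c y).card by omega) δ
    exact not_reachable_of_not_sees (mem_missing.1 hp) hδy hyz
      (hR p δ hpδ (mem_missing.1 hp) hδz)
  obtain ⟨q, q', hq, hq', hqq'⟩ := Finset.one_lt_card_iff.1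
    (show 1 < ((G.isolate x).missing c z).card by omega)
  obtain ⟨α, hα⟩ : ((G.isolate x).missing c y).Nonempty := Finset.card_pos.1 (by omega)
  rw [mem_missing] at hq hq' hα
  have hfan : ∀ q, ¬ (G.isolate x).Sees c z q → ∃ v, (G.isolate x).Adj y v ∧ c s(y, v) = q ∧
      v ≠ z ∧ ∀ t, (G.isolate x).Adj v t → t ≠ y → ¬ (G.isolate x).Sees c y (c s(v, t)) := by
    intro q hq
    have hyq : (G.isolate x).Sees c y q := by
      by_contra h
      exact hq (hdisj q h)
    obtain ⟨v, hv, hvq⟩ := hyq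
    have hvz : v ≠ z := by
      rintro rfl
      exact hq ⟨y, hv.symm, by rw [Sym2.eq_swap]; exact hvq⟩
    refine ⟨v, hv, hvq, hvz, fun t ht hty hs => ?_⟩
    -- There are `Δ + 2` minus the degree of `y` colors missing at `y`. Together with `q` they are
    -- at least as many as the edges at `v`, and each occurs at `v` because a path from `y` to `z`
    -- continues through `v`. Hence no other color fits at `v`.
    have hmem := mem_of_sees (c := c) (v := v) (T := insert q ((G.isolate x).missing c y)) ?_ ?_
      (δ := c s(v, t)) ⟨t, ht, rfl⟩
    · rcases Finset.mem_insert.1 hmem with h | h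
      · exact hty (hc.proper ht hv.symm (by rw [h, Sym2.eq_swap (a := v), hvq]))
      · exact mem_missing.1 h hs
    · rw [Finset.card_insert_of_notMem (fun h => mem_missing.1 h ⟨v, hv, hvq⟩)]
      have h1 := hG.add_le hv.1
      have h2 := numNeighbors_mono (G.isolate_le x) v
      omega
    · intro β hβ
      obtain rfl | hβ' := Finset.mem_insert.1 hβ
      · exact ⟨y, hv.symm, by rw [Sym2.eq_swap]; exact hvq⟩
      · replace hβ := mem_missing.1 hβ'
        have hβq : β ≠ q := by
          rintro rfl
          exact hβ ⟨v, hv, hvq⟩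
        obtain ⟨m, ⟨hm1, hm2⟩, hmy⟩ := (hc.isEnd_left hβ q).exists_second_adj (n := v)
          ⟨hv, Or.inr hvq⟩ hyz hvz (hR β q hβq hβ hq)
        refine ⟨m, hm1, hm2.resolve_right fun h => hmy ?_⟩
        exact hc.proper hm1 hv.symm (by rw [h, Sym2.eq_swap (a := v), hvq])
  obtain ⟨v, hv, hvq, hvz, hvp⟩ := hfan q hq
  obtain ⟨w, hw, hwq, hwz, hwp⟩ := hfan q' hq'
  have hvw : v ≠ w := by
    rintro rfl
    exact hqq' (hvq.symm.trans hwq)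
  obtain ⟨c', hex⟩ := exists_isExchange hv hw hvw hvp hwp
  have hαq : α ≠ q := by
    rintro rfl
    exact hα ⟨v, hv, hvq⟩
  have hr := hex.not_reachable hc hα hyz.symm hwz.symm
    (by rw [hvq]; exact hc.isEnd_left hq _)
    (by rw [hvq, twoColored_comm]; exact hR α q hαq hα hq)
  rw [hvq, twoColored_comm] at hr
  obtain ⟨c'', hc'', -⟩ := exists_valid_of_pair (hex.valid hc) hN hyz hαq
    (mt (hex.sees_center α).1 hα) (mt (hex.sees_of_ne hyz.symm hvz.symm hwz.symm q).1 hq) hr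
  exact hcon ⟨c'', hc''⟩

/-- Each neighbor of `y` forbids the at most two colors on its remaining edges, and `Δ + 1` exceeds
the degree of `y` by at least two. In a star coloring, one of any two neighbors misses both of their
new colors, so it is isolated for this pair and no bichromatic cycle arises. -/
theorem exists_valid_of_numNeighbors_lt {y : V} (hy : 4 ≤ G.numNeighbors y)
    (hyΔ : G.numNeighbors y < Δ) (hN : ∀ v, G.Adj y v → G.numNeighbors v ≤ 3)
    (ih : ∃ c : Sym2 V → Fin (Δ + 1), (G.isolate y).Valid c) :
    ∃ c : Sym2 V → Fin (Δ + 1), G.Valid c := by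
  classical
  obtain ⟨c, hc⟩ := ih
  obtain ⟨col, h1, -, h3, h4⟩ := exists_isStarColoring
    (P := fun v => ((G.isolate y).missing c v)ᶜ) (G.numNeighbors y - 3)
    (I := (Set.toFinite (G.neighborSet y)).toFinset) (D := Finset.univ)
    (by rw [← Set.ncard_eq_toFinset_card]; change G.numNeighbors y = _; omega)
    (by rw [Finset.card_univ, Fintype.card_fin]; omega)
    (by
      intro v hv
      have hv' : G.Adj y v := by simpa using hv
      have e1 := hc.card_missing v
      have e2 := numNeighbors_isolate hv'
      have e3 := hN v hv'
      rw [Finset.card_compl]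
      omega)
  simp only [Set.Finite.mem_toFinset, mem_neighborSet, Finset.mem_compl, mem_missing,
    not_not] at h1 h3 h4
  obtain ⟨c', hc', -⟩ := hc.extend col (fun v w hv hw e => h1 v hv w hw e) h3 (by
    intro v w hv hw hvw
    by_cases hs : (G.isolate y).Sees c w (col v)
    · exact not_reachable_of_not_sees (h3 v hv) (h4 v hv w hw hs) hvw
    · exact fun hr => not_reachable_of_not_sees hs (h3 w hw) hvw.symm hr.symm)
  exact ⟨c', hc'⟩

end Reductions

/-! ### Missing colors and bichromatic paths, abstractly -/

section Kempe

variable {V C : Type*} {M : V → C → Prop} {R : C → C → V → V → Prop} {a b u v : V}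

/-- The properties of the colors `M z` missing at `z`, and of the relation `R α β` of being
connected by edges colored `α` and `β`, that are used for finding colors of a pair of claws. -/
structure IsKempe (M : V → C → Prop) (R : C → C → V → V → Prop) : Prop where
  refl : ∀ α β z, R α β z z
  symm : ∀ {α β z w}, R α β z w → R α β w z
  comm : ∀ {α β z w}, R α β z w → R β α z w
  isolated : ∀ {α β z w}, M z α → M z β → z ≠ w → ¬ R α β z w
  ends : ∀ {α β z w t}, z ≠ w → z ≠ t → w ≠ t → (M z α ∨ M z β) → (M w α ∨ M w β) →
    (M t α ∨ M t β) → R α β z w → ¬ R α β z t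

/-- The colors `q` and `r` may be used for a path with ends `a` and `b`. -/
structure IsGood (M : V → C → Prop) (R : C → C → V → V → Prop) (a b : V) (q r : C) : Prop where
  left : M a q
  right : M b r
  ne : q ≠ r
  not_rel : ¬ R q r a b

/-- There is no bichromatic closed walk with colors `q` and `r` through two paths with ends `a`
and `b`, and `u` and `v`. -/
def IsOpen (R : C → C → V → V → Prop) (a b u v : V) (q r : C) : Prop :=
  ¬ (R q r a u ∧ R q r b v) ∧ ¬ (R q r a v ∧ R q r b u)

/-- Paths `a x b` and `u y v` cannot be colored in such a way that the edge `x y` can be colored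
as well. -/
def IsBlocked (M : V → C → Prop) (R : C → C → V → V → Prop) (a b u v : V) : Prop :=
  ∀ q r s t p, IsGood M R a b q r → IsGood M R u v s t → p ≠ q → p ≠ r → p ≠ s → p ≠ t →
    (q = s → r = t → IsOpen R a b u v q r) → (q = t → r = s → IsOpen R a b u v q r) →
    -- Each alternative is a bichromatic cycle through `x y` when `x y` has color `p`, `x a`, `x b`
    -- have colors `q`, `r`, and `y u`, `y v` have colors `s`, `t`. As `R` is reflexive, conflicts
    -- at a common outer neighbor are included.
    (q = s ∧ R q p a u) ∨ (q = t ∧ R q p a v) ∨ (r = s ∧ R r p b u) ∨ (r = t ∧ R r p b v)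

theorem IsGood.swap (hK : IsKempe M R) {q r : C} (h : IsGood M R a b q r) : IsGood M R b a r q :=
  ⟨h.right, h.left, h.ne.symm, fun h' => h.not_rel (hK.comm (hK.symm h'))⟩

theorem IsKempe.isGood (hK : IsKempe M R) {q r : C} (hab : a ≠ b) (hq : M a q) (hr : M b r)
    (hqr : q ≠ r) (h : M a r ∨ M b q) : IsGood M R a b q r := by
  refine ⟨hq, hr, hqr, ?_⟩
  rcases h with h | h
  · exact hK.isolated hq h hab
  · exact fun h' => hK.isolated h hr hab.symm (hK.symm h')

theorem IsOpen.flip (hK : IsKempe M R) {q r : C} (h : IsOpen R u v a b q r) :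
    IsOpen R a b u v q r :=
  ⟨fun h' => h.1 ⟨hK.symm h'.1, hK.symm h'.2⟩, fun h' => h.2 ⟨hK.symm h'.2, hK.symm h'.1⟩⟩

theorem IsOpen.comm (hK : IsKempe M R) {q r : C} (h : IsOpen R a b u v q r) :
    IsOpen R a b u v r q :=
  ⟨fun h' => h.1 ⟨hK.comm h'.1, hK.comm h'.2⟩, fun h' => h.2 ⟨hK.comm h'.1, hK.comm h'.2⟩⟩

theorem IsBlocked.swap_right (hK : IsKempe M R) (h : IsBlocked M R a b u v) :
    IsBlocked M R a b v u := by
  intro q r s t p h1 h2 p1 p2 p3 p4 j1 j2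
  have := h q r t s p h1 (h2.swap hK) p1 p2 p4 p3 (fun e1 e2 => (j2 e1 e2).symm)
    (fun e1 e2 => (j1 e1 e2).symm)
  tauto

theorem IsBlocked.flip (hK : IsKempe M R) (h : IsBlocked M R a b u v) :
    IsBlocked M R u v a b := by
  intro q r s t p h1 h2 p1 p2 p3 p4 j1 j2
  have := h s t q r p h2 h1 p3 p4 p1 p2 ?_ ?_
  · rcases this with ⟨rfl, h⟩ | ⟨rfl, h⟩ | ⟨rfl, h⟩ | ⟨rfl, h⟩
    · exact Or.inl ⟨rfl, hK.symm h⟩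
    · exact Or.inr (Or.inr (Or.inl ⟨rfl, hK.symm h⟩))
    · exact Or.inr (Or.inl ⟨rfl, hK.symm h⟩)
    · exact Or.inr (Or.inr (Or.inr ⟨rfl, hK.symm h⟩))
  · rintro rfl rfl
    exact (j1 rfl rfl).flip hK
  · rintro rfl rfl
    exact ((j2 rfl rfl).flip hK).comm hK

theorem IsBlocked.swap_left (hK : IsKempe M R) (h : IsBlocked M R a b u v) :
    IsBlocked M R b a u v :=
  ((h.flip hK).swap_right hK).flip hK

namespace IsBlocked

variable {q r s t p : C}

theorem false_of_disjoint (h : IsBlocked M R a b u v) (hqr : IsGood M R a b q r)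
    (hst : IsGood M R u v s t) (hp : ∃ p, p ≠ q ∧ p ≠ r ∧ p ≠ s ∧ p ≠ t) (qs : q ≠ s) (qt : q ≠ t)
    (rs : r ≠ s) (rt : r ≠ t) : False := by
  obtain ⟨p, p1, p2, p3, p4⟩ := hp
  have := h q r s t p hqr hst p1 p2 p3 p4 (fun e => absurd e qs) (fun e => absurd e qt)
  tauto

/-- When the pairs share exactly the color `q`, only one of the four alternatives is left, so a path
is forced for every free `p`. -/
theorem rel_left_left (h : IsBlocked M R a b u v) (hqr : IsGood M R a b q r)
    (hst : IsGood M R u v q t) (rt : r ≠ t) (pq : p ≠ q) (pr : p ≠ r) (pt : p ≠ t) :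
    R q p a u := by
  have := h q r q t p hqr hst pq pr pq pt (fun _ e => absurd e rt) (fun e => absurd e hst.ne)
  have h1 := hst.ne
  have h2 := hqr.ne.symm
  tauto

theorem rel_left_right (h : IsBlocked M R a b u v) (hK : IsKempe M R)
    (hqr : IsGood M R a b q r) (hst : IsGood M R u v s q) (rs : r ≠ s) (pq : p ≠ q) (pr : p ≠ r)
    (ps : p ≠ s) : R q p a v :=
  (h.swap_right hK).rel_left_left hqr (hst.swap hK) rs pq pr ps

theorem rel_right_left (h : IsBlocked M R a b u v) (hK : IsKempe M R)
    (hqr : IsGood M R a b q r) (hst : IsGood M R u v r t) (qt : q ≠ t) (pq : p ≠ q) (pr : p ≠ r)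
    (pt : p ≠ t) : R r p b u :=
  (h.swap_left hK).rel_left_left (hqr.swap hK) hst qt pr pq pt

theorem rel_right_right (h : IsBlocked M R a b u v) (hK : IsKempe M R)
    (hqr : IsGood M R a b q r) (hst : IsGood M R u v s r) (qs : q ≠ s) (pq : p ≠ q) (pr : p ≠ r)
    (ps : p ≠ s) : R r p b v :=
  (h.swap_left hK).rel_left_right hK (hqr.swap hK) hst qs pr pq ps

theorem rel_parallel (h : IsBlocked M R a b u v) (hqr : IsGood M R a b q r)
    (hst : IsGood M R u v q r) (ho : IsOpen R a b u v q r) (pq : p ≠ q) (pr : p ≠ r) :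
    R q p a u ∨ R r p b v := by
  have := h q r q r p hqr hst pq pr pq pr (fun _ _ => ho) (fun _ _ => ho)
  have h1 := hst.ne
  have h2 := hst.ne.symm
  tauto

theorem rel_crossed (h : IsBlocked M R a b u v) (hqr : IsGood M R a b q r)
    (hst : IsGood M R u v r q) (ho : IsOpen R a b u v q r) (pq : p ≠ q) (pr : p ≠ r) :
    R q p a v ∨ R r p b u := by
  have := h q r r q p hqr hst pq pr pr pq (fun _ _ => ho) (fun _ _ => ho)
  have h1 := hst.ne
  have h2 := hst.ne.symm
  tauto

end IsBlocked

/-! ### Four distinct outer neighbors -/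

/-- Distinct ends of two paths, at each of which at least two colors are missing. -/
structure IsKempeQuad (M : V → C → Prop) (R : C → C → V → V → Prop) (a b u v : V) : Prop
    extends IsKempe M R where
  blocked : IsBlocked M R a b u v
  ab : a ≠ b
  au : a ≠ u
  av : a ≠ v
  bu : b ≠ u
  bv : b ≠ v
  uv : u ≠ v
  two_a : ∀ α, ∃ β, M a β ∧ β ≠ α
  two_b : ∀ α, ∃ β, M b β ∧ β ≠ α
  two_u : ∀ α, ∃ β, M u β ∧ β ≠ α
  two_v : ∀ α, ∃ β, M v β ∧ β ≠ α
  five : ∀ α β γ δ : C, ∃ p, p ≠ α ∧ p ≠ β ∧ p ≠ γ ∧ p ≠ δ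

namespace IsKempeQuad

theorem flip (h : IsKempeQuad M R a b u v) : IsKempeQuad M R u v a b :=
  { h.toIsKempe with
    blocked := h.blocked.flip h.toIsKempe, ab := h.uv, au := h.au.symm, av := h.bu.symm,
    bu := h.av.symm, bv := h.bv.symm, uv := h.ab, two_a := h.two_u, two_b := h.two_v,
    two_u := h.two_a, two_v := h.two_b, five := h.five }

theorem swap_left (h : IsKempeQuad M R a b u v) : IsKempeQuad M R b a u v :=
  { h.toIsKempe with
    blocked := h.blocked.swap_left h.toIsKempe, ab := h.ab.symm, au := h.bu, av := h.bv,
    bu := h.au, bv := h.av, uv := h.uv, two_a := h.two_b, two_b := h.two_a,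
    two_u := h.two_u, two_v := h.two_v, five := h.five }

theorem swap_right (h : IsKempeQuad M R a b u v) : IsKempeQuad M R a b v u :=
  { h.toIsKempe with
    blocked := h.blocked.swap_right h.toIsKempe, ab := h.ab, au := h.av, av := h.au,
    bu := h.bv, bv := h.bu, uv := h.uv.symm, two_a := h.two_a, two_b := h.two_b,
    two_u := h.two_v, two_v := h.two_u, five := h.five }

variable {i j k p : C}

theorem isOpen_of_left (h : IsKempeQuad M R a b u v) (hi : M a i) (hj : M a j) :
    IsOpen R a b u v i j :=
  ⟨fun h' => h.isolated hi hj h.au h'.1, fun h' => h.isolated hi hj h.av h'.1⟩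

theorem isOpen_of_right (h : IsKempeQuad M R a b u v) (hi : M b i) (hj : M b j) :
    IsOpen R a b u v i j :=
  ⟨fun h' => h.isolated hi hj h.bv h'.2, fun h' => h.isolated hi hj h.bu h'.2⟩

theorem isOpen_of_left' (h : IsKempeQuad M R a b u v) (hi : M u i) (hj : M u j) :
    IsOpen R a b u v i j :=
  (h.flip.isOpen_of_left hi hj).flip h.toIsKempe

/-- The two paths have good pairs of colors that share one color. -/
theorem mem_of_shared (h : IsKempeQuad M R a b u v) (hij : IsGood M R a b i j)
    (hik : IsGood M R u v i k) (hjk : j ≠ k) {α : C} (hα : M a α) : α = i ∨ α = j ∨ α = k := by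
  by_contra hcon
  push Not at hcon
  exact h.isolated hij.left hα h.au
    (h.blocked.rel_left_left hij hik hjk hcon.1 hcon.2.1 hcon.2.2)

/-- An additional color `β` missing at `b` makes `(i, β)` good, since the `i`-`β` path from `a`
already ends at `u`. Then `j` is free for the edge `x y`, and the path forced by it shows that `j`
occurs at `u`. So `k` is missing at `u`, and a pair `(k, γ)` yields either a third end on a path or
two disjoint good pairs. -/
theorem mem_of_shared_right (h : IsKempeQuad M R a b u v) (hij : IsGood M R a b i j)
    (hik : IsGood M R u v i k) (hjk : j ≠ k) {β : C} (hβ : M b β) : β = i ∨ β = j ∨ β = k := by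
  have hK := h.toIsKempe
  by_contra hcon
  push Not at hcon
  obtain ⟨βi, βj, βk⟩ := hcon
  have hau : ∀ p, p ≠ i → p ≠ j → p ≠ k → R i p a u := fun p =>
    h.blocked.rel_left_left hij hik hjk
  have hiβ : IsGood M R a b i β := by
    refine ⟨hij.left, hβ, βi.symm, ?_⟩
    exact h.ends h.au h.ab h.bu.symm (Or.inl hij.left) (Or.inl hik.left) (Or.inr hβ)
      (hau β βi βj βk)
  have hju : R i j a u := h.blocked.rel_left_left hiβ hik βk hij.ne.symm βj.symm hjk
  have huj : ¬ M u j := fun h' => h.isolated hik.left h' h.au.symm (h.symm hju)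
  have huk : M u k := by
    obtain ⟨κ, hκ, hκi⟩ := h.two_u i
    rcases h.flip.mem_of_shared hik hij hjk.symm hκ with e | rfl | rfl
    exacts [absurd e hκi, hκ, absurd hκ huj]
  obtain ⟨γ, hγ, hγk⟩ := h.two_v k
  have hkγ : IsGood M R u v k γ := hK.isGood h.uv huk hγ hγk.symm (Or.inr hik.right)
  by_cases hγi : γ = i
  · subst hγi
    obtain ⟨p, pi, pj, pk, -⟩ := h.five γ j k k
    exact h.ends h.au h.av h.uv (Or.inl hij.left) (Or.inl hik.left) (Or.inl hγ) (hau p pi pj pk)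
      (h.blocked.rel_left_right hK hij hkγ hjk pi pj pk)
  · by_cases hγj : γ = j
    · subst hγj
      exact h.blocked.false_of_disjoint hiβ hkγ (h.five _ _ _ _) hik.ne (Ne.symm hγi) βk βj
    · exact h.blocked.false_of_disjoint hij hkγ (h.five _ _ _ _) hik.ne (Ne.symm hγi) hjk
        (Ne.symm hγj)

/-- The situation in which colors have to be exchanged at `a`. -/
structure IsTight (M : V → C → Prop) (R : C → C → V → V → Prop) (a b u v : V) (i j k κ : C) :
    Prop where
  ij : IsGood M R a b i j
  ik : IsGood M R u v i k
  jk : j ≠ k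
  iκ : i ≠ κ
  κ_eq : κ = j ∨ κ = k
  mem_a : M a κ
  eq_a : ∀ α, M a α → α = i ∨ α = κ
  eq_u : ∃ β γ, ∀ α, M u α → α = β ∨ α = γ
  eq_v : ∃ β γ, ∀ α, M v α → α = β ∨ α = γ
  rel : ∀ p, p ≠ i → p ≠ j → p ≠ k → R i p a u ∧ R κ p a v

/-- All missing colors lie in `{i, j, k}`, so exactly `j` and `k` are missing at `v`. If `j` is
missing at `u`, then both `a` and `u` miss exactly `i` and `j`, and `κ = j`. Otherwise both miss
exactly `i` and `k`, and `κ = k`. Other combinations give a path from an isolated vertex or a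
component with three ends. -/
theorem isTight_of_not_mem (h : IsKempeQuad M R a b u v) (hij : IsGood M R a b i j)
    (hik : IsGood M R u v i k) (hjk : j ≠ k) (hvi : ¬ M v i) :
    ∃ κ, IsTight M R a b u v i j k κ := by
  have hK := h.toIsKempe
  have nij := hij.ne
  have nik := hik.ne
  have nji := nij.symm
  have nki := nik.symm
  have nkj := hjk.symm
  have hai := hij.left
  have hbj := hij.right
  have hui := hik.left
  have hvk := hik.right
  have hau : ∀ p, p ≠ i → p ≠ j → p ≠ k → R i p a u := fun p =>
    h.blocked.rel_left_left hij hik hjk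
  have hA : ∀ {α}, M a α → α = i ∨ α = j ∨ α = k := h.mem_of_shared hij hik hjk
  have hB : ∀ {α}, M b α → α = i ∨ α = j ∨ α = k := h.mem_of_shared_right hij hik hjk
  have hU : ∀ {α}, M u α → α = i ∨ α = k ∨ α = j := h.flip.mem_of_shared hik hij nkj
  have hW : ∀ {α}, M v α → α = i ∨ α = k ∨ α = j := h.flip.mem_of_shared_right hik hij nkj
  obtain ⟨p, pi, pj, pk, -⟩ := h.five i j k k
  have hau' := hau p pi pj pk
  have hvj : M v j := by
    obtain ⟨γ, hγ, hγk⟩ := h.two_v k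
    rcases hW hγ with rfl | rfl | rfl
    exacts [absurd hγ hvi, absurd rfl hγk, hγ]
  have hWjk : ∀ α, M v α → α = j ∨ α = k := by
    intro α hα
    rcases hW hα with rfl | rfl | rfl
    exacts [absurd hα hvi, Or.inr rfl, Or.inl rfl]
  have hnbu : M b i → ∀ p, p ≠ i → p ≠ j → p ≠ k → ¬ R i p b u := fun hbi p pi pj pk h' =>
    h.ends h.au.symm h.bu.symm h.ab (Or.inl hui) (Or.inl hai) (Or.inl hbi)
      (h.symm (hau p pi pj pk)) (h.symm h')
  by_cases huj : M u j
  · have gij : IsGood M R u v i j := hK.isGood h.uv hui hvj nij (Or.inl huj)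
    have hik' : R i k a u := by
      rcases h.blocked.rel_parallel hij gij (h.isOpen_of_left' hui huj) nki nkj with h' | h'
      · exact h'
      · exact absurd (h.symm h') (h.isolated hvj hvk h.bv.symm)
    have hak : ¬ M a k := fun h' => h.isolated hai h' h.au hik'
    have huk : ¬ M u k := fun h' => h.isolated hui h' h.au.symm (h.symm hik')
    have haj : M a j := by
      obtain ⟨γ, hγ, hγi⟩ := h.two_a i
      rcases hA hγ with rfl | rfl | rfl
      exacts [absurd rfl hγi, hγ, absurd hγ hak]
    have hbi : ¬ M b i := by
      intro hbi
      have g1 : IsGood M R a b j i := hK.isGood h.ab haj hbi nji (Or.inl hai)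
      have g2 : IsGood M R u v j k := hK.isGood h.uv huj hvk hjk (Or.inr hvj)
      exact h.ends h.au.symm h.bu.symm h.ab (Or.inl huj) (Or.inl haj) (Or.inl hbj)
        (h.symm (h.blocked.rel_left_left g1 g2 nik pj pi pk))
        (h.symm (h.blocked.rel_right_left hK hij g2 nik pi pj pk))
    have hbk : M b k := by
      obtain ⟨γ, hγ, hγj⟩ := h.two_b j
      rcases hB hγ with rfl | rfl | rfl
      exacts [absurd hγ hbi, absurd rfl hγj, hγ]
    have g1 : IsGood M R a b j k := hK.isGood h.ab haj hbk hjk (Or.inr hbj)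
    refine ⟨j, hij, hik, hjk, nij, Or.inl rfl, haj, fun α hα => ?_, ⟨i, j, fun α hα => ?_⟩,
      ⟨j, k, hWjk⟩, fun p pi pj pk => ⟨hau p pi pj pk,
        h.blocked.rel_left_right hK g1 gij nki pj pk pi⟩⟩
    · rcases hA hα with e | e | rfl
      exacts [Or.inl e, Or.inr e, absurd hα hak]
    · rcases hU hα with e | rfl | e
      exacts [Or.inl e, absurd hα huk, Or.inr e]
  · have huk : M u k := by
      obtain ⟨γ, hγ, hγi⟩ := h.two_u i
      rcases hU hγ with rfl | rfl | rfl
      exacts [absurd rfl hγi, hγ, absurd hγ huj]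
    have gkj : IsGood M R u v k j := hK.isGood h.uv huk hvj nkj (Or.inr hvk)
    have hbv : R j p b v := h.blocked.rel_right_right hK hij gkj nik pi pj pk
    have hbi : ¬ M b i := by
      intro hbi
      have haj : ¬ M a j := by
        intro haj
        have g1 : IsGood M R a b j i := hK.isGood h.ab haj hbi nji (Or.inl hai)
        exact hnbu hbi p pi pj pk (h.blocked.rel_right_left hK g1 hik hjk pj pi pk)
      have hak : M a k := by
        obtain ⟨γ, hγ, hγi⟩ := h.two_a i
        rcases hA hγ with rfl | rfl | rfl
        exacts [absurd rfl hγi, absurd hγ haj, hγ]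
      have g1 : IsGood M R a b k i := hK.isGood h.ab hak hbi nki (Or.inl hai)
      rcases h.blocked.rel_crossed g1 hik (h.isOpen_of_left hak hai) hjk nji with h' | h'
      · exact h.isolated hvk hvj h.av.symm (h.symm h')
      · exact h.isolated hbi hbj h.bu h'
    have hbk : M b k := by
      obtain ⟨γ, hγ, hγj⟩ := h.two_b j
      rcases hB hγ with rfl | rfl | rfl
      exacts [absurd hγ hbi, absurd rfl hγj, hγ]
    have haj : ¬ M a j := by
      intro haj
      have g1 : IsGood M R a b j k := hK.isGood h.ab haj hbk hjk (Or.inr hbj)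
      have hbv' : R k p b v := h.blocked.rel_right_right hK g1 hik nji pj pk pi
      rcases h.blocked.rel_crossed g1 gkj (h.isOpen_of_right hbj hbk) pj pk with h' | h'
      · exact h.ends h.bv.symm h.av.symm h.ab.symm (Or.inl hvj) (Or.inl hbj) (Or.inl haj)
          (h.symm hbv) (h.symm h')
      · exact h.ends h.bv h.bu h.uv.symm (Or.inl hbk) (Or.inl hvk) (Or.inl huk) hbv' h'
    have hak : M a k := by
      obtain ⟨γ, hγ, hγi⟩ := h.two_a i
      rcases hA hγ with rfl | rfl | rfl
      exacts [absurd rfl hγi, absurd hγ haj, hγ]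
    have g1 : IsGood M R a b k j := hK.isGood h.ab hak hbj nkj (Or.inr hbk)
    refine ⟨k, hij, hik, hjk, nik, Or.inr rfl, hak, fun α hα => ?_, ⟨i, k, fun α hα => ?_⟩,
      ⟨j, k, hWjk⟩, fun p pi pj pk => ⟨hau p pi pj pk,
        h.blocked.rel_left_right hK g1 hik nji pk pj pi⟩⟩
    · rcases hA hα with e | rfl | e
      exacts [Or.inl e, absurd hα haj, Or.inr e]
    · rcases hU hα with e | e | rfl
      exacts [Or.inl e, Or.inr e, absurd hα huj]

/-- The `i`-`p` path between `a` and `u` cannot also reach `b` or `v`, which are ends too. This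
rules out `k` at `u` and `j` at `a` as missing colors, and leaves `κ = k`. -/
theorem isTight_of_mem (h : IsKempeQuad M R a b u v) (hij : IsGood M R a b i j)
    (hik : IsGood M R u v i k) (hjk : j ≠ k) (hbi : M b i) (hvi : M v i) :
    ∃ κ, IsTight M R a b u v i j k κ := by
  have hK := h.toIsKempe
  have nij := hij.ne
  have nik := hik.ne
  have nji := nij.symm
  have nki := nik.symm
  have nkj := hjk.symm
  have hai := hij.left
  have hbj := hij.right
  have hui := hik.left
  have hvk := hik.right
  have hau : ∀ p, p ≠ i → p ≠ j → p ≠ k → R i p a u := fun p =>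
    h.blocked.rel_left_left hij hik hjk
  have hA : ∀ {α}, M a α → α = i ∨ α = j ∨ α = k := h.mem_of_shared hij hik hjk
  have hU : ∀ {α}, M u α → α = i ∨ α = k ∨ α = j := h.flip.mem_of_shared hik hij nkj
  have hW : ∀ {α}, M v α → α = i ∨ α = k ∨ α = j := h.flip.mem_of_shared_right hik hij nkj
  have hnav : ∀ p, p ≠ i → p ≠ j → p ≠ k → ¬ R i p a v := fun p pi pj pk =>
    h.ends h.au h.av h.uv (Or.inl hai) (Or.inl hui) (Or.inl hvi) (hau p pi pj pk)
  have hnbu : ∀ p, p ≠ i → p ≠ j → p ≠ k → ¬ R i p b u := fun p pi pj pk h' =>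
    h.ends h.au.symm h.bu.symm h.ab (Or.inl hui) (Or.inl hai) (Or.inl hbi)
      (h.symm (hau p pi pj pk)) (h.symm h')
  obtain ⟨p, pi, pj, pk, -⟩ := h.five i j k k
  have huk : ¬ M u k := fun huk => hnav p pi pj pk (h.blocked.rel_left_right hK hij
    (hK.isGood h.uv huk hvi nki (Or.inl hui)) hjk pi pj pk)
  have haj : ¬ M a j := fun haj => hnbu p pi pj pk (h.blocked.rel_right_left hK
    (hK.isGood h.ab haj hbi nji (Or.inl hai)) hik hjk pj pi pk)
  have huj : M u j := by
    obtain ⟨γ, hγ, hγi⟩ := h.two_u i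
    rcases hU hγ with rfl | rfl | rfl
    exacts [absurd rfl hγi, absurd hγ huk, hγ]
  have hak : M a k := by
    obtain ⟨γ, hγ, hγi⟩ := h.two_a i
    rcases hA hγ with rfl | rfl | rfl
    exacts [absurd rfl hγi, absurd hγ haj, hγ]
  have g1 : IsGood M R a b k i := hK.isGood h.ab hak hbi nki (Or.inl hai)
  have hrel : ∀ p, p ≠ i → p ≠ k → ¬ R i p b u → R k p a v := fun p pi pk hn =>
    (h.blocked.rel_crossed g1 hik (h.isOpen_of_left hak hai) pk pi).resolve_right hn
  have hvj : ¬ M v j := fun hvj => h.isolated hvk hvj h.av.symm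
    (h.symm (hrel j nji hjk (h.isolated hbi hbj h.bu)))
  refine ⟨k, hij, hik, hjk, nik, Or.inr rfl, hak, fun α hα => ?_, ⟨i, j, fun α hα => ?_⟩,
    ⟨i, k, fun α hα => ?_⟩, fun p pi pj pk => ⟨hau p pi pj pk,
      hrel p pi pk (hnbu p pi pj pk)⟩⟩
  · rcases hA hα with e | rfl | e
    exacts [Or.inl e, absurd hα haj, Or.inr e]
  · rcases hU hα with e | rfl | e
    exacts [Or.inl e, absurd hα huk, Or.inr e]
  · rcases hW hα with e | e | rfl
    exacts [Or.inl e, Or.inr e, absurd hα hvj]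

/-- If good pairs of colors share one color, then all missing colors are known. -/
theorem isTight_of_shared (h : IsKempeQuad M R a b u v) (hij : IsGood M R a b i j)
    (hik : IsGood M R u v i k) (hjk : j ≠ k) :
    (∃ κ, IsTight M R a b u v i j k κ) ∨ ∃ κ, IsTight M R u v a b i k j κ := by
  by_cases hvi : M v i
  · by_cases hbi : M b i
    · exact Or.inl (h.isTight_of_mem hij hik hjk hbi hvi)
    · exact Or.inr (h.flip.isTight_of_not_mem hik hij hjk.symm hbi)
  · exact Or.inl (h.isTight_of_not_mem hij hik hjk hvi)

/-- If all good pairs of colors consist of `i` and `j`, then only these colors are missing. -/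
theorem missing_of_unique (h : IsKempeQuad M R a b u v) (hab : IsGood M R a b i j)
    (huv : IsGood M R u v i j) (ho : IsOpen R a b u v i j)
    (huniq : ∀ q r, IsGood M R a b q r → (q = i ∨ q = j) ∧ (r = i ∨ r = j)) :
    (∀ α, M a α ↔ α = i ∨ α = j) ∧ (∀ α, M b α ↔ α = i ∨ α = j) := by
  have hA : ∀ α, M a α → α = i ∨ α = j := by
    intro α hα
    by_contra hcon
    push Not at hcon
    -- By uniqueness `(α, j)` is not a good pair, so there is a path from `b` to `a`; blocking gives
    -- a second one from `b` to `v`.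
    have hn : R α j a b := by
      by_contra hn
      exact absurd (huniq α j ⟨hα, hab.right, hcon.2, hn⟩).1 (by tauto)
    have h1 := (h.blocked.rel_parallel hab huv ho hcon.1 hcon.2).resolve_left
      (h.isolated hab.left hα h.au)
    exact h.ends h.ab.symm h.bv h.av (Or.inr hab.right) (Or.inl hα) (Or.inr huv.right)
      (h.symm hn) (h.comm h1)
  have hB : ∀ α, M b α → α = i ∨ α = j := by
    intro α hα
    by_contra hcon
    push Not at hcon
    have hn : R i α a b := by
      by_contra hn
      exact absurd (huniq i α ⟨hab.left, hα, hcon.1.symm, hn⟩).2 (by tauto)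
    have h1 := (h.blocked.rel_parallel hab huv ho hcon.1 hcon.2).resolve_right
      (h.isolated hab.right hα h.bv)
    exact h.ends h.ab h.au h.bu (Or.inl hab.left) (Or.inr hα) (Or.inl huv.left) hn h1
  refine ⟨fun α => ⟨hA α, ?_⟩, fun α => ⟨hB α, ?_⟩⟩
  · rintro (rfl | rfl)
    · exact hab.left
    · obtain ⟨γ, hγ, hγi⟩ := h.two_a i
      rcases hA γ hγ with rfl | rfl
      exacts [absurd rfl hγi, hγ]
  · rintro (rfl | rfl)
    · obtain ⟨γ, hγ, hγi⟩ := h.two_b j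
      rcases hB γ hγ with rfl | rfl
      exacts [hγ, absurd rfl hγi]
    · exact hab.right

end IsKempeQuad

/-! ### A common outer neighbor -/

/-- The situation in which colors have to be exchanged at a common end of the two paths. -/
structure IsTightCommon (M : V → C → Prop) (R : C → C → V → V → Prop) (a b v : V) (r t z : C) :
    Prop where
  rt : r ≠ t
  zr : z ≠ r
  zt : z ≠ t
  mem_a : M a r ∧ M a t ∧ M a z
  mem_b : M b r
  mem_v : M v t
  eq_b : ∀ α, M b α → α = r ∨ α = t ∨ α = z
  eq_v : ∀ α, M v α → α = r ∨ α = t ∨ α = z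
  not_mem_b : b ≠ v → ¬ M b t
  not_mem_v : b ≠ v → ¬ M v r
  rel : ∀ p, p ≠ r → p ≠ t → p ≠ z → R r p a b ∧ R t p a v

/-- Three colors are missing at the common neighbor `a`. If one of them is also missing at `b` and a
different one at `v`, then pairs sharing a single color force paths from `a` to `b` and from `a` to
`v`. The case `b = v` is allowed throughout. -/
theorem IsBlocked.exists_isTightCommon (h : IsBlocked M R a b a v) (hK : IsKempe M R) (ab : a ≠ b)
    (av : a ≠ v) (three_a : ∀ α β, ∃ γ, M a γ ∧ γ ≠ α ∧ γ ≠ β) (two_b : ∀ α, ∃ β, M b β ∧ β ≠ α)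
    (two_v : ∀ α, ∃ β, M v β ∧ β ≠ α) (five : ∀ α β γ δ : C, ∃ p, p ≠ α ∧ p ≠ β ∧ p ≠ γ ∧ p ≠ δ)
    {q r s t : C} (hqr : IsGood M R a b q r) (hst : IsGood M R a v s t) (hqs : q ≠ s)
    (hrt : b = v → r ≠ t) : ∃ r t z, IsTightCommon M R a b v r t z := by
  -- Without a color missing at both `a` and `b`, the given pairs share at most one color. If they
  -- share one, an unused color missing at `a` or at `b` makes the forced path start at an isolated
  -- vertex.
  have meet : ∀ {b v : V}, IsBlocked M R a b a v → a ≠ b → a ≠ v → (∀ α, ∃ β, M b β ∧ β ≠ α) →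
      ∀ {q r s t : C}, IsGood M R a b q r → IsGood M R a v s t → q ≠ s → (b = v → r ≠ t) →
      ∃ α, M a α ∧ M b α := by
    intro b v h ab av two_b q r s t hqr hst hqs hrt
    by_contra hcon
    push Not at hcon
    have hdis : ∀ {α β}, M a α → M b β → α ≠ β := by
      rintro α _ h1 h2 rfl
      exact hcon _ h1 h2
    have hrs : r ≠ s := (hdis hst.left hqr.right).symm
    by_cases htq : t = q
    · subst htq
      obtain ⟨p, hp, hpq, hps⟩ := three_a t s
      have hpr := hdis hp hqr.right
      have h1 := h t r s t p hqr hst hpq hpr hps hpq (fun e => absurd e hqs)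
        (fun _ e => absurd e hrs)
      have h2 := hK.isolated hqr.left hp av
      have h3 := hqr.ne.symm
      tauto
    by_cases htr : t = r
    · subst htr
      obtain ⟨p, hp, hpt⟩ := two_b t
      have hqp := (hdis hqr.left hp).symm
      have hsp := (hdis hst.left hp).symm
      have h1 := h q t s t p hqr hst hqp hpt hsp hpt (fun e => absurd e hqs)
        (fun e => absurd e hqr.ne)
      have h2 : ¬ R t p b v := hK.isolated hqr.right hp fun e => hrt e rfl
      have h3 := hqr.ne
      tauto
    · exact h.false_of_disjoint hqr hst (five _ _ _ _) hqs (Ne.symm htq) hrs (Ne.symm htr)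
  obtain ⟨r₀, har₀, hbr₀⟩ := meet h ab av two_b hqr hst hqs hrt
  obtain ⟨t₀, hat₀, hvt₀⟩ := meet (h.flip hK) av ab two_v hst hqr hqs.symm
    (fun e => (hrt e.symm).symm)
  obtain ⟨r, t, har, hbr, hat, hvt, hrt⟩ : ∃ r t, M a r ∧ M b r ∧ M a t ∧ M v t ∧ r ≠ t := by
    by_cases hne : r₀ = t₀
    · subst hne
      obtain ⟨γ, hγ, hγr⟩ := two_v r₀
      by_cases haγ : M a γ
      · exact ⟨r₀, γ, har₀, hbr₀, haγ, hγ, hγr.symm⟩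
      -- The colors `z` and `p` are missing at `a`. The pairs `(z, r₀)` and `(r₀, γ)` leave only an
      -- `r₀`-`p` path between `b` and `a`, but `a` is isolated for these colors.
      · exfalso
        obtain ⟨z, hz, hzr, -⟩ := three_a r₀ r₀
        obtain ⟨p, hp, hpr, hpz⟩ := three_a r₀ z
        have hzγ : z ≠ γ := by rintro rfl; exact haγ hz
        have hpγ : p ≠ γ := by rintro rfl; exact haγ hp
        have h1 := h z r₀ r₀ γ p (hK.isGood ab hz hbr₀ hzr (Or.inl har₀))
          (hK.isGood av har₀ hγ hγr.symm (Or.inr hvt₀)) hpz hpr hpr hpγ (fun e => absurd e hzr)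
          (fun e => absurd e hzγ)
        have h2 : ¬ R r₀ p b a := fun h' => hK.isolated har₀ hp ab (hK.symm h')
        have h3 := hγr.symm
        tauto
    · exact ⟨r₀, t₀, har₀, hbr₀, hat₀, hvt₀, hne⟩
  have htr := hrt.symm
  obtain ⟨z, haz, hzr, hzt⟩ := three_a r t
  have hrz := hzr.symm
  have htz := hzt.symm
  have g1 : IsGood M R a b z r := hK.isGood ab haz hbr hzr (Or.inl har)
  have g2 : IsGood M R a v r t := hK.isGood av har hvt hrt (Or.inl hat)
  have g3 : IsGood M R a b t r := hK.isGood ab hat hbr htr (Or.inl har)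
  have g4 : IsGood M R a v z t := hK.isGood av haz hvt hzt (Or.inl hat)
  have k1 : ∀ p, p ≠ r → p ≠ t → p ≠ z → R r p a b := fun p pr pt pz =>
    hK.symm (h.rel_right_left hK g1 g2 hzt pz pr pt)
  have k2 : ∀ p, p ≠ r → p ≠ t → p ≠ z → R t p a v := fun p pr pt pz =>
    h.rel_left_right hK g3 g4 hrz pt pr pz
  obtain ⟨p, pr, pt, pz, -⟩ := five r t z z
  have eq_a : ∀ α, M a α → α = r ∨ α = t ∨ α = z := by
    intro α hα
    by_contra hcon
    push Not at hcon
    exact hK.isolated har hα ab (k1 α hcon.1 hcon.2.1 hcon.2.2)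
  refine ⟨r, t, z, hrt, hzr, hzt, ⟨har, hat, haz⟩, hbr, hvt, fun β hβ => ?_, fun γ hγ => ?_,
    fun bv hbt => ?_, fun bv hvr => ?_, fun p pr pt pz => ⟨k1 p pr pt pz, k2 p pr pt pz⟩⟩
  · by_contra hcon
    push Not at hcon
    exact h.false_of_disjoint (hK.isGood ab har hβ hcon.1.symm (Or.inr hbr)) g4 (five _ _ _ _)
      hrz hrt hcon.2.2 hcon.2.1
  · by_contra hcon
    push Not at hcon
    exact h.false_of_disjoint g1 (hK.isGood av hat hγ hcon.2.1.symm (Or.inr hvt)) (five _ _ _ _)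
      hzt (Ne.symm hcon.2.2) hrt (Ne.symm hcon.1)
  · have h1 := h.rel_right_right hK (hK.isGood ab haz hbt hzt (Or.inl hat)) g2 hzr pz pt pr
    exact hK.ends av.symm bv.symm ab (Or.inl hvt) (Or.inl hat) (Or.inl hbt)
      (hK.symm (k2 p pr pt pz)) (hK.symm h1)
  · have h1 := h.rel_right_right hK g1 (hK.isGood av hat hvr htr (Or.inl har)) hzt pz pr pt
    exact hK.ends ab.symm bv av (Or.inl hbr) (Or.inl har) (Or.inl hvr)
      (hK.symm (k1 p pr pt pz)) h1

end Kempe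

/-! ### An edge between two vertices of degree 3 -/

section Link

variable {V C : Type*} {G : SimpleGraph V} {x y a b u v : V}

/-- The edge `x y`, whose ends have the further neighbors `a` and `b`, and `u` and `v`. -/
structure IsLink (G : SimpleGraph V) (x y a b u v : V) : Prop where
  left : ∀ w, G.Adj x w ↔ w = y ∨ w = a ∨ w = b
  right : ∀ w, G.Adj y w ↔ w = x ∨ w = u ∨ w = v
  ab : a ≠ b
  uv : u ≠ v
  ay : a ≠ y
  by' : b ≠ y
  ux : u ≠ x
  vx : v ≠ x

/-- The graph without the edges at `x` and `y`. -/
def core (G : SimpleGraph V) (x y : V) : SimpleGraph V := (G.isolate y).isolate x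

theorem core_comm (G : SimpleGraph V) (x y : V) : G.core x y = G.core y x := by
  ext s t
  simp only [core, isolate_adj]
  tauto

namespace IsLink

theorem flip (h : IsLink G x y a b u v) : IsLink G y x u v a b :=
  ⟨h.right, h.left, h.uv, h.ab, h.ux, h.vx, h.ay, h.by'⟩

theorem swap_left (h : IsLink G x y a b u v) : IsLink G x y b a u v :=
  { h with left := fun w => by rw [h.left]; tauto, ab := h.ab.symm, ay := h.by', by' := h.ay }

theorem swap_right (h : IsLink G x y a b u v) : IsLink G x y a b v u :=
  { h with right := fun w => by rw [h.right]; tauto, uv := h.uv.symm, ux := h.vx, vx := h.ux }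

theorem adj (h : IsLink G x y a b u v) : G.Adj x y := (h.left y).2 (Or.inl rfl)

theorem adj_a (h : IsLink G x y a b u v) : G.Adj x a := (h.left a).2 (Or.inr (Or.inl rfl))

theorem adj_b (h : IsLink G x y a b u v) : G.Adj x b := (h.left b).2 (Or.inr (Or.inr rfl))

theorem adj_u (h : IsLink G x y a b u v) : G.Adj y u := h.flip.adj_a

theorem adj_v (h : IsLink G x y a b u v) : G.Adj y v := h.flip.adj_b

theorem isKempe {K : SimpleGraph V} {c : Sym2 V → C} (hc : K.Valid c) :
    IsKempe (fun z α => ¬ K.Sees c z α) (fun α β => (K.twoColored c α β).Reachable) where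
  refl _ _ _ := Reachable.refl _
  symm h := h.symm
  comm h := by rwa [twoColored_comm]
  isolated h1 h2 h3 := not_reachable_of_not_sees h1 h2 h3
  ends := by
    intro α β z w t zw zt wt h1 h2 h3 r1 r2
    exact wt ((hc.isLinear α β).eq_of_isEnd
      (h1.elim (fun h => hc.isEnd_left h _) fun h => hc.isEnd_right h _)
      (h2.elim (fun h => hc.isEnd_left h _) fun h => hc.isEnd_right h _)
      (h3.elim (fun h => hc.isEnd_left h _) fun h => hc.isEnd_right h _) zw zt r1 r2)

/-- If none of the listed paths existed, the coloring would extend to all of `G`: first to the edges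
`x a` and `x b`, then to the three edges at `y`. -/
theorem isBlocked (h : IsLink G x y a b u v) (hG : ∀ c : Sym2 V → C, ¬ G.Valid c)
    {c : Sym2 V → C} (hc : (G.core x y).Valid c) :
    IsBlocked (fun z α => ¬ (G.core x y).Sees c z α)
      (fun α β => ((G.core x y).twoColored c α β).Reachable) a b u v := by
  classical
  intro q r s t p hqr hst pq pr ps pt j1 j2
  by_contra hcon
  have hN : (G.isolate y).neighborSet x = {a, b} := by
    ext w
    simp only [mem_neighborSet, isolate_adj, h.left, Set.mem_insert_iff, Set.mem_singleton_iff]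
    constructor
    · rintro ⟨h1, -, h2⟩
      exact h1.resolve_left h2
    · intro hw
      refine ⟨Or.inr hw, h.adj.ne, ?_⟩
      rintro rfl
      rcases hw with e | e
      exacts [h.ay e.symm, h.by' e.symm]
  obtain ⟨c₁, hc₁, hsame, hxa, hxb⟩ := exists_valid_of_pair (G := G.isolate y) hc hN h.ab hqr.ne
    hqr.left hqr.right hqr.not_rel
  have hadj : ∀ w, (G.isolate y).Adj x w ↔ w = a ∨ w = b := fun w => by
    rw [← mem_neighborSet, hN]; rfl
  have hle : ∀ α β s t, s ≠ x → t ≠ x → ((G.isolate y).twoColored c₁ α β).Adj s t →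
      ((G.core x y).twoColored c α β).Adj s t := by
    rintro α β s t hs ht ⟨h1, h2⟩
    rw [hsame s t hs ht] at h2
    exact ⟨⟨h1, hs, ht⟩, h2⟩
  -- The color `p` is not on `x a` or `x b`, so `x` is an end and a path from it enters the core
  -- through the one neighbor joined to it by color `α`.
  have hxuv : ∀ w α, w ≠ x → α ≠ p → p ≠ q → p ≠ r →
      ((G.isolate y).twoColored c₁ α p).Reachable x w →
      (q = α ∧ ((G.core x y).twoColored c q p).Reachable a w) ∨
      (r = α ∧ ((G.core x y).twoColored c r p).Reachable b w) := by
    intro w α hw hαp pq pr hreach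
    have hend : ((G.isolate y).twoColored c₁ α p).IsEnd x := by
      have key : ∀ n, ((G.isolate y).twoColored c₁ α p).Adj x n → c₁ s(x, n) = α := by
        rintro n ⟨h1, h2⟩
        refine h2.resolve_right fun h2 => ?_
        rcases (hadj n).1 h1 with rfl | rfl
        · exact pq (h2.symm.trans hxa)
        · exact pr (h2.symm.trans hxb)
      intro m n hm hn
      exact hc₁.proper hm.1 hn.1 ((key m hm).trans (key n hn).symm)
    obtain ⟨n, hn⟩ := exists_adj_of_reachable hw.symm hreach
    have hnx : n ≠ x := hn.ne.symm
    have h1 := hend.reachable (hle α p) hnx hw (hn.symm.reachable.trans hreach)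
    obtain ⟨hn1, hn2⟩ := hn
    rcases (hadj n).1 hn1 with rfl | rfl
    · rw [hxa] at hn2
      obtain rfl := hn2.resolve_right pq.symm
      exact Or.inl ⟨rfl, h1⟩
    · rw [hxb] at hn2
      obtain rfl := hn2.resolve_right pr.symm
      exact Or.inr ⟨rfl, h1⟩
  have hxu : ¬ ((G.isolate y).twoColored c₁ s p).Reachable x u := by
    intro h'
    rcases hxuv u s h.ux ps.symm pq pr h' with ⟨h1, h2⟩ | ⟨h1, h2⟩
    exacts [hcon (Or.inl ⟨h1, h2⟩), hcon (Or.inr (Or.inr (Or.inl ⟨h1, h2⟩)))]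
  have hxv : ¬ ((G.isolate y).twoColored c₁ t p).Reachable x v := by
    intro h'
    rcases hxuv v t h.vx pt.symm pq pr h' with ⟨h1, h2⟩ | ⟨h1, h2⟩
    exacts [hcon (Or.inr (Or.inl ⟨h1, h2⟩)), hcon (Or.inr (Or.inr (Or.inr ⟨h1, h2⟩)))]
  have huv : ¬ ((G.isolate y).twoColored c₁ s t).Reachable u v := by
    intro h'
    by_cases hend : ((G.isolate y).twoColored c₁ s t).IsEnd x
    · exact hst.not_rel (hend.reachable (hle s t) h.ux h.vx h')
    -- A path from `u` to `v` can pass through `x` only if both edges at `x` have colors `s` and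
    -- `t`; this is the case that `IsOpen` excludes.
    · have hboth : (q = s ∧ r = t) ∨ (q = t ∧ r = s) := by
        simp only [IsEnd, not_forall] at hend
        obtain ⟨m, n, hm, hn, hmn⟩ := hend
        obtain ⟨hm1, hm2⟩ := hm
        obtain ⟨hn1, hn2⟩ := hn
        have := hqr.ne
        rcases (hadj m).1 hm1 with rfl | rfl <;> rcases (hadj n).1 hn1 with rfl | rfl
        · exact absurd rfl hmn
        · rw [hxa] at hm2; rw [hxb] at hn2; grind
        · rw [hxb] at hm2; rw [hxa] at hn2; grind
        · exact absurd rfl hmn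
      have hopen : IsOpen (fun α β => ((G.core x y).twoColored c α β).Reachable) a b u v s t := by
        rcases hboth with ⟨rfl, rfl⟩ | ⟨rfl, rfl⟩
        · exact j1 rfl rfl
        · exact (j2 rfl rfl).comm (isKempe hc)
      rcases reachable_of_neighbors (a := a) (b := b) (fun n
        (hn : ((G.isolate y).twoColored c₁ s t).Adj x n) => (hadj n).1 hn.1) (hle s t)
        h.ux h.vx h' with h1 | ⟨h1, h2⟩ | ⟨h1, h2⟩
      · exact hst.not_rel h1
      · exact hopen.1 ⟨h1.symm, h2⟩
      · exact hopen.2 ⟨h2, h1.symm⟩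
  have hsees : ∀ w α, w ≠ x → ¬ (G.core x y).Sees c w α → (w = a → q ≠ α) → (w = b → r ≠ α) →
      ¬ (G.isolate y).Sees c₁ w α := by
    rintro w α hwx hnot hwa hwb ⟨n, hn, hn'⟩
    by_cases hnx : n = x
    · subst hnx
      rw [Sym2.eq_swap] at hn'
      rcases (hadj w).1 hn.symm with rfl | rfl
      · exact hwa rfl (hxa.symm.trans hn')
      · exact hwb rfl (hxb.symm.trans hn')
    · rw [hsame w n hwx hnx] at hn'
      exact hnot ⟨n, ⟨hn, hwx, hnx⟩, hn'⟩
  have hsu : ¬ (G.isolate y).Sees c₁ u s := by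
    refine hsees u s h.ux hst.left ?_ ?_
    · rintro rfl e
      exact hcon (Or.inl ⟨e, Reachable.refl _⟩)
    · rintro rfl e
      exact hcon (Or.inr (Or.inr (Or.inl ⟨e, Reachable.refl _⟩)))
  have htv : ¬ (G.isolate y).Sees c₁ v t := by
    refine hsees v t h.vx hst.right ?_ ?_
    · rintro rfl e
      exact hcon (Or.inr (Or.inl ⟨e, Reachable.refl _⟩))
    · rintro rfl e
      exact hcon (Or.inr (Or.inr (Or.inr ⟨e, Reachable.refl _⟩)))
  have hpx : ¬ (G.isolate y).Sees c₁ x p := by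
    rintro ⟨n, hn, hn'⟩
    rcases (hadj n).1 hn with rfl | rfl
    exacts [pq (hn'.symm.trans hxa), pr (hn'.symm.trans hxb)]
  have hvu := h.uv.symm
  have hxu' := h.ux.symm
  have hxv' := h.vx.symm
  have hux' := h.ux
  have hvx' := h.vx
  have hst' := hst.ne
  have hts' := hst.ne.symm
  have ps' := ps.symm
  have pt' := pt.symm
  obtain ⟨c₂, hc₂, -⟩ := hc₁.extend (fun w => if w = u then s else if w = v then t else p) (by
      intro m n hm hn
      rcases (h.right m).1 hm with rfl | rfl | rfl <;>
        rcases (h.right n).1 hn with rfl | rfl | rfl <;> simp_all) (by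
      intro m hm
      rcases (h.right m).1 hm with rfl | rfl | rfl
      · simpa [hxu', hxv']
      · simpa
      · simpa [hvu]) (by
      intro m n hm hn hmn
      rcases (h.right m).1 hm with rfl | rfl | rfl <;>
        rcases (h.right n).1 hn with rfl | rfl | rfl
      · exact absurd rfl hmn
      · simp only [hxu', hxv', if_true, if_false]
        rwa [twoColored_comm]
      · simp only [hxu', hxv', hvu, if_true, if_false]
        rwa [twoColored_comm]
      · simp only [hxu', hxv', if_true, if_false]
        exact fun h' => hxu h'.symm
      · exact absurd rfl hmn
      · simp only [hvu, if_true, if_false]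
        exact huv
      · simp only [hxu', hxv', hvu, if_true, if_false]
        exact fun h' => hxv h'.symm
      · simp only [hvu, if_true, if_false]
        rw [twoColored_comm]
        exact fun h' => huv h'.symm
      · exact absurd rfl hmn)
  exact hG c₂ hc₂

/-- A coloring without the edge `x y` gives good pairs of colors. -/
theorem exists_good (h : IsLink G x y a b u v) {c : Sym2 V → C}
    (hc : (G.deleteEdges {s(x, y)}).Valid c) :
    (G.core x y).Valid c ∧ ∃ q r s t,
      IsGood (fun z α => ¬ (G.core x y).Sees c z α)
        (fun α β => ((G.core x y).twoColored c α β).Reachable) a b q r ∧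
      IsGood (fun z α => ¬ (G.core x y).Sees c z α)
        (fun α β => ((G.core x y).twoColored c α β).Reachable) u v s t ∧
      (q = s → r = t →
        IsOpen (fun α β => ((G.core x y).twoColored c α β).Reachable) a b u v q r) ∧
      (q = t → r = s →
        IsOpen (fun α β => ((G.core x y).twoColored c α β).Reachable) a b u v q r) ∧
      (a = u → q ≠ s) ∧ (a = v → q ≠ t) ∧ (b = u → r ≠ s) ∧ (b = v → r ≠ t) := by
  set K := G.deleteEdges {s(x, y)} with hK
  have hxy := h.adj.ne
  have hKadj : ∀ {s t}, K.Adj s t ↔ G.Adj s t ∧ s(s, t) ≠ s(x, y) := by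
    intro s t
    rw [hK, deleteEdges_adj, Set.mem_singleton_iff]
  have hle : G.core x y ≤ K := by
    rintro s t ⟨⟨h1, h2, h3⟩, h4, h5⟩
    refine hKadj.2 ⟨h1, fun e => ?_⟩
    rcases Sym2.eq_iff.1 e with ⟨e, _⟩ | ⟨e, _⟩
    exacts [h4 e, h2 e]
  have hxw : ∀ {w}, G.Adj x w → w ≠ y → K.Adj x w := fun hw hwy =>
    hKadj.2 ⟨hw, fun e => hwy (Sym2.congr_right.1 e)⟩
  have hyw : ∀ {w}, G.Adj y w → w ≠ x → K.Adj y w := fun hw hwx =>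
    hKadj.2 ⟨hw, fun e => by
      rcases Sym2.eq_iff.1 e with ⟨e, _⟩ | ⟨_, e⟩
      exacts [hxy e.symm, hwx e]⟩
  have ka := hxw h.adj_a h.ay
  have kb := hxw h.adj_b h.by'
  have ku := hyw h.adj_u h.ux
  have kv := hyw h.adj_v h.vx
  have hsee : ∀ {w z}, K.Adj z w → (z = x ∨ z = y) →
      ¬ (G.core x y).Sees c w (c s(z, w)) := by
    rintro w z hzw hz ⟨n, hn, hn'⟩
    have := hc.proper (hle hn) hzw.symm (by rw [hn', Sym2.eq_swap])
    subst this
    rcases hz with rfl | rfl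
    exacts [hn.2.2 rfl, hn.1.2.2 rfl]
  have hxne : ∀ {α β s t}, ((G.core x y).twoColored c α β).Adj s t →
      ((K.isolate x).twoColored c α β).Adj s t := fun h' => ⟨⟨hle h'.1, h'.1.2⟩, h'.2⟩
  have hyne : ∀ {α β s t}, ((G.core x y).twoColored c α β).Adj s t →
      ((K.isolate y).twoColored c α β).Adj s t := fun h' => ⟨⟨hle h'.1, h'.1.1.2⟩, h'.2⟩
  have gab : IsGood (fun z α => ¬ (G.core x y).Sees c z α)
      (fun α β => ((G.core x y).twoColored c α β).Reachable) a b (c s(x, a)) (c s(x, b)) :=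
    ⟨hsee ka (Or.inl rfl), hsee kb (Or.inl rfl), fun e => h.ab (hc.proper ka kb e),
      fun hr => hc.not_reachable_isolate ka kb h.ab (hr.mono fun _ _ => hxne)⟩
  have guv : IsGood (fun z α => ¬ (G.core x y).Sees c z α)
      (fun α β => ((G.core x y).twoColored c α β).Reachable) u v (c s(y, u)) (c s(y, v)) :=
    ⟨hsee ku (Or.inr rfl), hsee kv (Or.inr rfl), fun e => h.uv (hc.proper ku kv e),
      fun hr => hc.not_reachable_isolate ku kv h.uv (hr.mono fun _ _ => hyne)⟩
  have huv : ∀ {α β}, (c s(y, u) = α ∨ c s(y, u) = β) → (c s(y, v) = α ∨ c s(y, v) = β) →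
      ((K.isolate x).twoColored c α β).Reachable u v := by
    intro α β h1 h2
    have e1 : ((K.isolate x).twoColored c α β).Adj y u := ⟨⟨ku, hxy.symm, h.ux⟩, h1⟩
    have e2 : ((K.isolate x).twoColored c α β).Adj y v := ⟨⟨kv, hxy.symm, h.vx⟩, h2⟩
    exact e1.symm.reachable.trans e2.reachable
  have hopen : (c s(y, u) = c s(x, a) ∨ c s(y, u) = c s(x, b)) →
      (c s(y, v) = c s(x, a) ∨ c s(y, v) = c s(x, b)) →
      IsOpen (fun α β => ((G.core x y).twoColored c α β).Reachable) a b u v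
        (c s(x, a)) (c s(x, b)) := by
    intro h1 h2
    have h3 := huv h1 h2
    refine ⟨fun h' => hc.not_reachable_isolate ka kb h.ab ?_,
      fun h' => hc.not_reachable_isolate ka kb h.ab ?_⟩
    · exact ((h'.1.mono fun _ _ => hxne).trans h3).trans (h'.2.mono fun _ _ => hxne).symm
    · exact ((h'.1.mono fun _ _ => hxne).trans h3.symm).trans (h'.2.mono fun _ _ => hxne).symm
  have hdiff : ∀ {w w'}, K.Adj x w → K.Adj y w' → w = w' → c s(x, w) ≠ c s(y, w') := by
    rintro w _ h1 h2 rfl e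
    exact hxy (hc.proper h1.symm h2.symm (by rw [Sym2.eq_swap, e, Sym2.eq_swap]))
  exact ⟨hc.mono hle, _, _, _, _, gab, guv, fun e1 e2 => hopen (Or.inl e1.symm) (Or.inr e2.symm),
    fun e1 e2 => hopen (Or.inr e2.symm) (Or.inl e1.symm), hdiff ka ku, hdiff ka kv, hdiff kb ku,
    hdiff kb kv⟩

end IsLink

/-- A neighbor `n` of `a` is suitable for an exchange if there are bichromatic paths from `a`
through `n` for two colors that are missing at `a`. -/
theorem Valid.pure_of_reachable [Finite V] {K : SimpleGraph V} {c : Sym2 V → C} (hc : K.Valid c)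
    {a n w w' : V} {i κ : C} (hn : K.Adj a n) (hi : ¬ K.Sees c a i) (hκ : ¬ K.Sees c a κ)
    (hiκ : i ≠ κ) (hdeg : K.numNeighbors n ≤ 3) (haw : a ≠ w) (hnw : n ≠ w) (haw' : a ≠ w')
    (hnw' : n ≠ w') (hr : (K.twoColored c i (c s(a, n))).Reachable a w)
    (hr' : (K.twoColored c κ (c s(a, n))).Reachable a w') :
    ∀ t, K.Adj n t → t ≠ a → ¬ K.Sees c a (c s(n, t)) := by
  classical
  have hsees : ∀ {i w}, ¬ K.Sees c a i → a ≠ w → n ≠ w →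
      (K.twoColored c i (c s(a, n))).Reachable a w → K.Sees c n i := by
    intro i w hi haw hnw hr
    obtain ⟨m, ⟨hm, hm'⟩, hma⟩ := (hc.isEnd_left hi _).exists_second_adj ⟨hn, Or.inr rfl⟩ haw hnw hr
    refine ⟨m, hm, hm'.resolve_right fun e => hma (hc.proper hm hn.symm ?_)⟩
    rw [e, Sym2.eq_swap]
  have hself : K.Sees c n (c s(a, n)) := ⟨a, hn.symm, by rw [Sym2.eq_swap]⟩
  have hia : i ≠ c s(a, n) := by
    rintro rfl
    exact hi ⟨n, hn, rfl⟩
  have hκa : κ ≠ c s(a, n) := by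
    rintro rfl
    exact hκ ⟨n, hn, rfl⟩
  intro t ht hta
  -- The at most three edges at `n` carry `i`, `κ` and the color of `a n`: both paths run through
  -- `n` and do not stop there.
  have hmem := mem_of_sees (T := {i, κ, c s(a, n)}) (δ := c s(n, t)) (c := c) (v := n)
    (by rwa [Finset.card_eq_three.2 ⟨i, κ, c s(a, n), hiκ, hia, hκa, rfl⟩]) (by
      simp only [Finset.mem_insert, Finset.mem_singleton]
      rintro α (rfl | rfl | rfl)
      exacts [hsees hi haw hnw hr, hsees hκ haw' hnw' hr', hself]) ⟨t, ht, rfl⟩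
  simp only [Finset.mem_insert, Finset.mem_singleton] at hmem
  rcases hmem with e | e | e
  · rwa [e]
  · rwa [e]
  · exact absurd (hc.proper ht hn.symm (by rw [e, Sym2.eq_swap])) hta

end Link

/-! ### Finding an exchange at an outer neighbor -/

section Exchange

variable {V C : Type*} {G K : SimpleGraph V} {x y a b u v : V} {Δ : ℕ}

/-- Good pairs avoiding the exchanged colors survive, so the blocking condition can be applied again
to the new coloring. -/
theorem IsExchange.isGood {c c' : Sym2 V → C} {v₁ v₂ : V} (h : K.IsExchange c c' a v₁ v₂)
    {q r : C} (q₁ : q ≠ c s(a, v₁)) (q₂ : q ≠ c s(a, v₂)) (r₁ : r ≠ c s(a, v₁))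
    (r₂ : r ≠ c s(a, v₂))
    (hg : IsGood (fun z α => ¬ K.Sees c z α) (fun α β => (K.twoColored c α β).Reachable) u v q r) :
    IsGood (fun z α => ¬ K.Sees c' z α) (fun α β => (K.twoColored c' α β).Reachable) u v q r := by
  refine ⟨mt (h.sees_iff_of_color q₁ q₂ u).1 hg.left, mt (h.sees_iff_of_color r₁ r₂ v).1 hg.right,
    hg.ne, ?_⟩
  rw [h.twoColored_eq q₁ q₂ r₁ r₂]
  exact hg.not_rel

theorem exists_two_ne (hΔ : 4 ≤ Δ) (α β γ : Fin (Δ + 1)) :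
    ∃ p p', p ≠ p' ∧ (p ≠ α ∧ p ≠ β ∧ p ≠ γ) ∧ p' ≠ α ∧ p' ≠ β ∧ p' ≠ γ := by
  have h1 : 1 < (Finset.univ \ {α, β, γ} : Finset (Fin (Δ + 1))).card := by
    have := Finset.le_card_sdiff {α, β, γ} (Finset.univ : Finset (Fin (Δ + 1)))
    have h3 := Finset.card_le_three (a := α) (b := β) (c := γ)
    rw [Finset.card_univ, Fintype.card_fin] at this
    omega
  obtain ⟨p, p', hp, hp', hne⟩ := Finset.one_lt_card_iff.1 h1
  simp only [Finset.mem_sdiff, Finset.mem_univ, true_and, Finset.mem_insert,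
    Finset.mem_singleton, not_or] at hp hp'
  exact ⟨p, p', hne, hp, hp'⟩

theorem exists_ne_four (hΔ : 4 ≤ Δ) (α β γ δ : Fin (Δ + 1)) :
    ∃ p, p ≠ α ∧ p ≠ β ∧ p ≠ γ ∧ p ≠ δ := by
  obtain ⟨p, p', hne, hp, hp'⟩ := exists_two_ne hΔ α β γ
  by_cases h : p = δ
  · exact ⟨p', hp'.1, hp'.2.1, hp'.2.2, fun e => hne (h.trans e.symm)⟩
  · exact ⟨p, hp.1, hp.2.1, hp.2.2, h⟩

variable {c : Sym2 V → Fin (Δ + 1)}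

theorem numNeighbors_ge_of_missing (hc : K.Valid c) {z : V} {α β γ : Fin (Δ + 1)}
    (h : ∀ δ, ¬ K.Sees c z δ → δ = α ∨ δ = β ∨ δ = γ) : Δ ≤ K.numNeighbors z + 2 := by
  have h1 : K.missing c z ⊆ {α, β, γ} := by
    intro δ hδ
    simp only [Finset.mem_insert, Finset.mem_singleton]
    exact h δ (mem_missing.1 hδ)
  have h2 := (Finset.card_le_card h1).trans Finset.card_le_three
  have h3 := hc.card_missing z
  rw [Fintype.card_fin] at h3
  omega

theorem numNeighbors_ge_of_missing_two (hc : K.Valid c) {z : V} {α β : Fin (Δ + 1)}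
    (h : ∀ δ, ¬ K.Sees c z δ → δ = α ∨ δ = β) : Δ ≤ K.numNeighbors z + 1 := by
  have h1 : K.missing c z ⊆ {α, β} := by
    intro δ hδ
    simp only [Finset.mem_insert, Finset.mem_singleton]
    exact h δ (mem_missing.1 hδ)
  have h2 := (Finset.card_le_card h1).trans Finset.card_le_two
  have h3 := hc.card_missing z
  rw [Fintype.card_fin] at h3
  omega

theorem exists_missing_ne (hc : K.Valid c) {z : V} (hz : K.numNeighbors z + 1 ≤ Δ)
    (α : Fin (Δ + 1)) : ∃ β, ¬ K.Sees c z β ∧ β ≠ α := by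
  have h3 := hc.card_missing z
  rw [Fintype.card_fin] at h3
  obtain ⟨β, hβ, hne⟩ := Finset.exists_mem_ne (show 1 < (K.missing c z).card by omega) α
  exact ⟨β, mem_missing.1 hβ, hne⟩

theorem exists_missing_ne_ne (hc : K.Valid c) {z : V} (hz : K.numNeighbors z + 2 ≤ Δ)
    (α β : Fin (Δ + 1)) : ∃ γ, ¬ K.Sees c z γ ∧ γ ≠ α ∧ γ ≠ β := by
  have h3 := hc.card_missing z
  rw [Fintype.card_fin] at h3
  obtain ⟨γ, hγ, hne⟩ := Finset.exists_mem_notMem_of_card_lt_card (s := {α, β})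
    (t := K.missing c z) (Finset.card_le_two.trans_lt (by omega))
  simp only [Finset.mem_insert, Finset.mem_singleton, not_or] at hne
  exact ⟨γ, mem_missing.1 hγ, hne⟩

theorem core_le (G : SimpleGraph V) (x y : V) : G.core x y ≤ G :=
  ((G.isolate y).isolate_le x).trans (G.isolate_le y)

variable [Finite V]

theorem numNeighbors_core_lt {z : V} (h : G.Adj x z ∨ G.Adj y z) :
    (G.core x y).numNeighbors z + 1 ≤ G.numNeighbors z := by
  rcases h with h | h
  · have h1 := numNeighbors_isolate h
    have h2 := numNeighbors_mono ((G.isolate x).isolate_le y) z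
    rw [core_comm, core]
    omega
  · have h1 := numNeighbors_isolate h
    have h2 := numNeighbors_mono ((G.isolate y).isolate_le x) z
    rw [core]
    omega

theorem numNeighbors_core_of_common {z : V} (hxy : x ≠ y) (hx : G.Adj x z) (hy : G.Adj y z) :
    (G.core x y).numNeighbors z + 2 ≤ G.numNeighbors z := by
  have h1 := numNeighbors_isolate hy
  have h2 := numNeighbors_isolate (G := G.isolate y) (x := x) (v := z) ⟨hx, hxy, hy.ne.symm⟩
  rw [core]
  omega

/-- Bichromatic paths from a vertex `a` of large degree for the color pairs `i p`, `κ p`, `i p'`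
and `κ p'` make it possible to exchange the colors `p` and `p'` at `a`. -/
theorem IsReducible.exists_exchange (hG : G.IsReducible Δ) (hK : K ≤ G) (hc : K.Valid c)
    {i κ p p' : Fin (Δ + 1)} (hi : ¬ K.Sees c a i) (hκ : ¬ K.Sees c a κ) (hiκ : i ≠ κ)
    (hpp' : p ≠ p') (ha : 4 ≤ G.numNeighbors a)
    (h : ∀ β, β = i ∨ β = κ → ∀ ρ, ρ = p ∨ ρ = p' → ∃ w, a ≠ w ∧ 4 ≤ G.numNeighbors w ∧
      (K.twoColored c β ρ).Reachable a w) :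
    ∃ c' v₁ v₂, K.IsExchange c c' a v₁ v₂ ∧ c s(a, v₁) = p ∧ c s(a, v₂) = p' ∧
      ∀ w, 4 ≤ G.numNeighbors w → w ≠ v₁ ∧ w ≠ v₂ := by
  have spoke : ∀ ρ, ρ = p ∨ ρ = p' → ∃ n, K.Adj a n ∧ c s(a, n) = ρ ∧ G.numNeighbors n ≤ 3 ∧
      ∀ t, K.Adj n t → t ≠ a → ¬ K.Sees c a (c s(n, t)) := by
    intro ρ hρ
    obtain ⟨w, haw, hw, hr⟩ := h i (Or.inl rfl) ρ hρ
    obtain ⟨w', haw', hw', hr'⟩ := h κ (Or.inr rfl) ρ hρ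
    obtain ⟨n, hn, hn'⟩ := exists_adj_of_reachable haw hr
    have hnρ : c s(a, n) = ρ := hn'.resolve_left fun e => hi ⟨n, hn, e⟩
    have hn3 : G.numNeighbors n ≤ 3 := (hG.sparse a n (hK hn)).resolve_left (by omega)
    have hne : ∀ {w}, 4 ≤ G.numNeighbors w → n ≠ w := by
      rintro _ h rfl
      omega
    subst hnρ
    exact ⟨n, hn, rfl, hn3, hc.pure_of_reachable hn hi hκ hiκ
      ((numNeighbors_mono hK n).trans hn3) haw (hne hw) haw' (hne hw') hr hr'⟩
  obtain ⟨v₁, h1, hp, h1', h1''⟩ := spoke p (Or.inl rfl)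
  obtain ⟨v₂, h2, hp', h2', h2''⟩ := spoke p' (Or.inr rfl)
  have hne : v₁ ≠ v₂ := by
    rintro rfl
    exact hpp' (hp.symm.trans hp')
  obtain ⟨c', hex⟩ := exists_isExchange h1 h2 hne h1'' h2''
  refine ⟨c', v₁, v₂, hex, hp, hp', fun w hw => ⟨?_, ?_⟩⟩
  · rintro rfl; omega
  · rintro rfl; omega

end Exchange

/-! ### Coloring an edge between two vertices of degree 3 -/

namespace IsLink

variable {V : Type*} [Finite V] {G : SimpleGraph V} {x y a b u v : V} {Δ : ℕ}
  {c : Sym2 V → Fin (Δ + 1)}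

theorem isKempeQuad (h : IsLink G x y a b u v) (hG : G.IsReducible Δ) (hΔ : 4 ≤ Δ)
    (hcol : ∀ c : Sym2 V → Fin (Δ + 1), ¬ G.Valid c) (hc : (G.core x y).Valid c) (au : a ≠ u)
    (av : a ≠ v) (bu : b ≠ u) (bv : b ≠ v) :
    IsKempeQuad (fun z α => ¬ (G.core x y).Sees c z α)
      (fun α β => ((G.core x y).twoColored c α β).Reachable) a b u v :=
  { isKempe hc with
    blocked := h.isBlocked hcol hc
    ab := h.ab, au := au, av := av, bu := bu, bv := bv, uv := h.uv
    two_a := exists_missing_ne hc ((numNeighbors_core_lt (Or.inl h.adj_a)).trans (hG.le _))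
    two_b := exists_missing_ne hc ((numNeighbors_core_lt (Or.inl h.adj_b)).trans (hG.le _))
    two_u := exists_missing_ne hc ((numNeighbors_core_lt (Or.inr h.adj_u)).trans (hG.le _))
    two_v := exists_missing_ne hc ((numNeighbors_core_lt (Or.inr h.adj_v)).trans (hG.le _))
    five := exists_ne_four hΔ }

/-- At most two colors are missing at `a`, `u` and `v`, so each has degree at least `Δ ≥ 4` in `G`
and an exchange of `p` and `p'` at `a` is possible. The new coloring is blocked too, which forces
the `i`-`p` path from `a` to `u` that the exchange has just destroyed. -/
theorem false_of_isTight (h : IsLink G x y a b u v) (hG : G.IsReducible Δ) (hΔ : 4 ≤ Δ)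
    (hcol : ∀ c : Sym2 V → Fin (Δ + 1), ¬ G.Valid c) (hc : (G.core x y).Valid c) (au : a ≠ u)
    (av : a ≠ v) {i j k κ : Fin (Δ + 1)}
    (ht : IsKempeQuad.IsTight (fun z α => ¬ (G.core x y).Sees c z α)
      (fun α β => ((G.core x y).twoColored c α β).Reachable) a b u v i j k κ) : False := by
  have ha := numNeighbors_ge_of_missing_two hc ht.eq_a
  obtain ⟨_, _, eq_u⟩ := ht.eq_u
  obtain ⟨_, _, eq_v⟩ := ht.eq_v
  have hu := numNeighbors_ge_of_missing_two hc eq_u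
  have hv := numNeighbors_ge_of_missing_two hc eq_v
  have ha' := numNeighbors_core_lt (Or.inl h.adj_a : G.Adj x a ∨ G.Adj y a)
  have hu' := numNeighbors_core_lt (Or.inr h.adj_u : G.Adj x u ∨ G.Adj y u)
  have hv' := numNeighbors_core_lt (Or.inr h.adj_v : G.Adj x v ∨ G.Adj y v)
  obtain ⟨p, p', hpp', ⟨pi, pj, pk⟩, pi', pj', pk'⟩ := exists_two_ne hΔ i j k
  have hrel : ∀ ρ, ρ = p ∨ ρ = p' → ((G.core x y).twoColored c i ρ).Reachable a u ∧
      ((G.core x y).twoColored c κ ρ).Reachable a v := by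
    rintro ρ (rfl | rfl)
    exacts [ht.rel _ pi pj pk, ht.rel _ pi' pj' pk']
  obtain ⟨c', v₁, v₂, hex, rfl, rfl, hne⟩ := hG.exists_exchange (core_le G x y) hc ht.ij.left
    ht.mem_a ht.iκ hpp' (by omega) (by
      rintro β (rfl | rfl) ρ hρ
      · exact ⟨u, au, by omega, (hrel ρ hρ).1⟩
      · exact ⟨v, av, by omega, (hrel ρ hρ).2⟩)
  have hb := h.isBlocked hcol (hex.valid hc)
  have h1 := hb.rel_left_left (hex.isGood pi.symm pi'.symm pj.symm pj'.symm ht.ij)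
    (hex.isGood pi.symm pi'.symm pk.symm pk'.symm ht.ik) ht.jk pi pj pk
  rw [twoColored_comm] at h1
  refine hex.not_reachable hc ht.ij.left au.symm (hne u (by omega)).2
    (hc.isEnd_right ht.ik.left _) ?_ h1
  rw [twoColored_comm]
  exact (hrel _ (Or.inl rfl)).1

theorem false_of_shared (h : IsLink G x y a b u v) (hG : G.IsReducible Δ) (hΔ : 4 ≤ Δ)
    (hcol : ∀ c : Sym2 V → Fin (Δ + 1), ¬ G.Valid c) (hc : (G.core x y).Valid c) (au : a ≠ u)
    (av : a ≠ v) (bu : b ≠ u) (bv : b ≠ v) {i j k : Fin (Δ + 1)}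
    (hij : IsGood (fun z α => ¬ (G.core x y).Sees c z α)
      (fun α β => ((G.core x y).twoColored c α β).Reachable) a b i j)
    (hik : IsGood (fun z α => ¬ (G.core x y).Sees c z α)
      (fun α β => ((G.core x y).twoColored c α β).Reachable) u v i k) (hjk : j ≠ k) : False := by
  rcases (h.isKempeQuad hG hΔ hcol hc au av bu bv).isTight_of_shared hij hik hjk with
    ⟨κ, ht⟩ | ⟨κ, ht⟩
  · exact h.false_of_isTight hG hΔ hcol hc au av ht
  · rw [core_comm] at hc ht
    exact h.flip.false_of_isTight hG hΔ hcol hc au.symm bu.symm ht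

/-- Here no single path is forced, but both parallel and crossed assignments of `i` and `j` are
blocked. Together with the bound on ends they give, for `i` and for `j` with any other color, a path
from `a` to `u` or to `v`. This is enough for an exchange at `a`. -/
theorem false_of_same (h : IsLink G x y a b u v) (hG : G.IsReducible Δ) (hΔ : 4 ≤ Δ)
    (hcol : ∀ c : Sym2 V → Fin (Δ + 1), ¬ G.Valid c) (hc : (G.core x y).Valid c) (au : a ≠ u)
    (av : a ≠ v) (bu : b ≠ u) (bv : b ≠ v) {i j : Fin (Δ + 1)} (hij : i ≠ j)
    (hA : ∀ α, ¬ (G.core x y).Sees c a α ↔ α = i ∨ α = j)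
    (hB : ∀ α, ¬ (G.core x y).Sees c b α ↔ α = i ∨ α = j)
    (hU : ∀ α, ¬ (G.core x y).Sees c u α ↔ α = i ∨ α = j)
    (hW : ∀ α, ¬ (G.core x y).Sees c v α ↔ α = i ∨ α = j) : False := by
  have ha := numNeighbors_ge_of_missing_two hc fun δ => (hA δ).1
  have hu := numNeighbors_ge_of_missing_two hc fun δ => (hU δ).1
  have hv := numNeighbors_ge_of_missing_two hc fun δ => (hW δ).1
  have ha' := numNeighbors_core_lt (Or.inl h.adj_a : G.Adj x a ∨ G.Adj y a)
  have hu' := numNeighbors_core_lt (Or.inr h.adj_u : G.Adj x u ∨ G.Adj y u)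
  have hv' := numNeighbors_core_lt (Or.inr h.adj_v : G.Adj x v ∨ G.Adj y v)
  have hQ := h.isKempeQuad hG hΔ hcol hc au av bu bv
  have hK := hQ.toIsKempe
  have ai := (hA i).2 (Or.inl rfl)
  have aj := (hA j).2 (Or.inr rfl)
  have bi := (hB i).2 (Or.inl rfl)
  have bj := (hB j).2 (Or.inr rfl)
  have ui := (hU i).2 (Or.inl rfl)
  have uj := (hU j).2 (Or.inr rfl)
  have vi := (hW i).2 (Or.inl rfl)
  have vj := (hW j).2 (Or.inr rfl)
  have gij := hK.isGood hQ.ab ai bj hij (Or.inl aj)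
  have gji := hK.isGood hQ.ab aj bi hij.symm (Or.inl ai)
  have gij' := hK.isGood hQ.uv ui vj hij (Or.inl uj)
  have gji' := hK.isGood hQ.uv uj vi hij.symm (Or.inl ui)
  have key : ∀ ρ, ρ ≠ i → ρ ≠ j → ∀ β, β = i ∨ β = j →
      ((G.core x y).twoColored c β ρ).Reachable a u ∨
      ((G.core x y).twoColored c β ρ).Reachable a v := by
    intro ρ ρi ρj β hβ
    have h1 := hQ.blocked.rel_parallel gij gij' (hQ.isOpen_of_left ai aj) ρi ρj
    have h2 := hQ.blocked.rel_crossed gij gji' (hQ.isOpen_of_left ai aj) ρi ρj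
    have h3 := hQ.blocked.rel_crossed gji gij' (hQ.isOpen_of_left aj ai) ρj ρi
    have h4 := hQ.blocked.rel_parallel gji gji' (hQ.isOpen_of_left aj ai) ρj ρi
    have h5 := hQ.ends bu bv hQ.uv (Or.inl bi) (Or.inl ui) (Or.inl vi) (β := ρ)
    have h6 := hQ.ends bu bv hQ.uv (Or.inl bj) (Or.inl uj) (Or.inl vj) (β := ρ)
    rcases hβ with rfl | rfl <;> tauto
  obtain ⟨p, p', hpp', ⟨pi, pj, -⟩, pi', pj', -⟩ := exists_two_ne hΔ i j j
  have main : ∀ {u v}, IsLink G x y a b u v → a ≠ u → b ≠ u → b ≠ v → 4 ≤ G.numNeighbors u →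
      (¬ (G.core x y).Sees c u i ∧ ¬ (G.core x y).Sees c u j) →
      (¬ (G.core x y).Sees c v i ∧ ¬ (G.core x y).Sees c v j) →
      IsKempeQuad (fun z α => ¬ (G.core x y).Sees c z α)
        (fun α β => ((G.core x y).twoColored c α β).Reachable) a b u v →
      ((G.core x y).twoColored c i p).Reachable a u → False := by
    intro u v h au bu bv hu huij hvij hQ hrau
    obtain ⟨c', v₁, v₂, hex, rfl, rfl, hne⟩ := hG.exists_exchange (core_le G x y) hc ai aj hij
      hpp' (by omega) (by
        rintro β hβ ρ hρ
        have : ρ ≠ i ∧ ρ ≠ j := by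
          rcases hρ with rfl | rfl
          exacts [⟨pi, pj⟩, ⟨pi', pj'⟩]
        rcases key ρ this.1 this.2 β hβ with h' | h'
        · exact ⟨_, ‹_›, by omega, h'⟩
        · exact ⟨_, av, by omega, h'⟩)
    have gij' := hK.isGood hQ.uv huij.1 hvij.2 hij (Or.inl huij.2)
    have gji' := hK.isGood hQ.uv huij.2 hvij.1 hij.symm (Or.inl huij.1)
    have hrbu := (hQ.blocked.rel_crossed gij gji' (hQ.isOpen_of_left ai aj) pi pj).resolve_left
      (hQ.ends au hQ.av hQ.uv (Or.inl ai) (Or.inl huij.1) (Or.inl hvij.1) hrau)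
    have hQ' := h.isKempeQuad hG hΔ hcol (hex.valid hc) au hQ.av bu bv
    have hgood := hex.isGood pi.symm pi'.symm pj.symm pj'.symm gij
    have hgood' := hex.isGood pi.symm pi'.symm pj.symm pj'.symm gij'
    rcases hQ'.blocked.rel_parallel hgood hgood'
      (hQ'.isOpen_of_left hgood.left (mt (hex.sees_center j).1 aj)) pi pj with h1 | h1
    · rw [twoColored_comm] at h1
      refine hex.not_reachable hc ai au.symm (hne u hu).2 (hc.isEnd_right huij.1 _) ?_ h1
      rw [twoColored_comm]
      exact hrau
    -- The path between `b` and `v` existed before the exchange, since it has both ends away from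
    -- `a`; with `hrbu` its component has three ends.
    · rw [twoColored_comm] at h1
      have h2 := hex.reachable_of_reachable hc aj hQ.ab.symm hQ.av.symm h1
      rw [twoColored_comm] at h2
      exact hQ.ends bu bv hQ.uv (Or.inl bj) (Or.inl huij.2) (Or.inl hvij.2) hrbu h2
  rcases key p pi pj i (Or.inl rfl) with h' | h'
  · exact main h au bu bv (by omega) ⟨ui, uj⟩ ⟨vi, vj⟩ hQ h'
  · exact main h.swap_right av bv bu (by omega) ⟨vi, vj⟩ ⟨ui, uj⟩ hQ.swap_right h'

theorem false_of_distinct (h : IsLink G x y a b u v) (hG : G.IsReducible Δ) (hΔ : 4 ≤ Δ)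
    (hcol : ∀ c : Sym2 V → Fin (Δ + 1), ¬ G.Valid c) (au : a ≠ u) (av : a ≠ v) (bu : b ≠ u)
    (bv : b ≠ v) (hc : (G.deleteEdges {s(x, y)}).Valid c) : False := by
  obtain ⟨hc, q, r, s, t, hqr, hst, j1, j2, -⟩ := h.exists_good hc
  have hQ := h.isKempeQuad hG hΔ hcol hc au av bu bv
  have hK := hQ.toIsKempe
  -- Pairs sharing exactly one color are excluded by `false_of_shared`, disjoint pairs by a fifth
  -- color on `x y`.
  have hsame : ∀ q r s t, IsGood (fun z α => ¬ (G.core x y).Sees c z α)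
      (fun α β => ((G.core x y).twoColored c α β).Reachable) a b q r →
      IsGood (fun z α => ¬ (G.core x y).Sees c z α)
        (fun α β => ((G.core x y).twoColored c α β).Reachable) u v s t →
      (q = s ∧ r = t) ∨ (q = t ∧ r = s) := by
    intro q r s t hqr hst
    by_contra hcon
    by_cases qs : q = s
    · subst qs
      exact h.false_of_shared hG hΔ hcol hc au av bu bv hqr hst (by tauto)
    by_cases qt : q = t
    · subst qt
      exact h.swap_right.false_of_shared hG hΔ hcol hc av au bv bu hqr (hst.swap hK) (by tauto)
    by_cases rs : r = s
    · subst rs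
      exact h.swap_left.false_of_shared hG hΔ hcol hc bu bv au av (hqr.swap hK) hst (by tauto)
    by_cases rt : r = t
    · subst rt
      exact h.swap_left.swap_right.false_of_shared hG hΔ hcol hc bv bu av au (hqr.swap hK)
        (hst.swap hK) (by tauto)
    exact hQ.blocked.false_of_disjoint hqr hst (exists_ne_four hΔ _ _ _ _) qs qt rs rt
  have main : ∀ {u v}, IsLink G x y a b u v → a ≠ u → a ≠ v → b ≠ u → b ≠ v →
      IsKempeQuad (fun z α => ¬ (G.core x y).Sees c z α)
        (fun α β => ((G.core x y).twoColored c α β).Reachable) a b u v →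
      IsGood (fun z α => ¬ (G.core x y).Sees c z α)
        (fun α β => ((G.core x y).twoColored c α β).Reachable) u v q r →
      IsOpen (fun α β => ((G.core x y).twoColored c α β).Reachable) a b u v q r →
      (∀ q r s t, IsGood (fun z α => ¬ (G.core x y).Sees c z α)
        (fun α β => ((G.core x y).twoColored c α β).Reachable) a b q r →
        IsGood (fun z α => ¬ (G.core x y).Sees c z α)
          (fun α β => ((G.core x y).twoColored c α β).Reachable) u v s t →
        (q = s ∧ r = t) ∨ (q = t ∧ r = s)) → False := by
    intro u v h au av bu bv hQ huv ho hsame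
    obtain ⟨hA, hB⟩ := hQ.missing_of_unique hqr huv ho fun q' r' hg => by
      have := hsame q' r' q r hg huv
      tauto
    obtain ⟨hU, hW⟩ := hQ.flip.missing_of_unique huv hqr (ho.flip hK) fun q' r' hg => by
      rcases hsame q r q' r' hqr hg with ⟨h1, h2⟩ | ⟨h1, h2⟩
      · exact ⟨Or.inl h1.symm, Or.inr h2.symm⟩
      · exact ⟨Or.inr h2.symm, Or.inl h1.symm⟩
    exact h.false_of_same hG hΔ hcol hc au av bu bv hqr.ne hA hB hU hW
  rcases hsame q r s t hqr hst with ⟨rfl, rfl⟩ | ⟨rfl, rfl⟩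
  · exact main h au av bu bv hQ hst (j1 rfl rfl) hsame
  · refine main h.swap_right av au bv bu hQ.swap_right (hst.swap hK) (j2 rfl rfl).symm
      fun q' r' s' t' h1 h2 => ?_
    exact (hsame q' r' t' s' h1 (h2.swap hK)).symm

/-- The vertex `a` loses two edges in the core and misses three colors there. As in the distinct
case, the exchange at `a` breaks the `r`-`p` path to `b`, while blocking in the new coloring demands
it. -/
theorem false_of_common (h : IsLink G x y a b a v) (hG : G.IsReducible Δ) (hΔ : 4 ≤ Δ)
    (hcol : ∀ c : Sym2 V → Fin (Δ + 1), ¬ G.Valid c)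
    (hc : (G.deleteEdges {s(x, y)}).Valid c) : False := by
  obtain ⟨hc, q, r, s, t, hqr, hst, -, -, hqs, -, -, hrt⟩ := h.exists_good hc
  have hxy := h.adj.ne
  have ha' := numNeighbors_core_of_common hxy h.adj_a h.adj_u
  have hb' := numNeighbors_core_lt (Or.inl h.adj_b : G.Adj x b ∨ G.Adj y b)
  have hv' := numNeighbors_core_lt (Or.inr h.adj_v : G.Adj x v ∨ G.Adj y v)
  obtain ⟨r, t, z, ht⟩ := (h.isBlocked hcol hc).exists_isTightCommon (isKempe hc) h.ab h.uv
    (exists_missing_ne_ne hc (ha'.trans (hG.le a))) (exists_missing_ne hc (hb'.trans (hG.le b)))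
    (exists_missing_ne hc (hv'.trans (hG.le v))) (exists_ne_four hΔ) hqr hst (hqs rfl) hrt
  obtain ⟨har, hat, haz⟩ := ht.mem_a
  have hK := isKempe hc
  have hA : Δ ≤ (G.core x y).numNeighbors a + 2 := by
    refine numNeighbors_ge_of_missing hc (α := r) (β := t) (γ := z) fun δ hδ => ?_
    by_contra hcon
    push Not at hcon
    exact hK.isolated har hδ h.ab (ht.rel δ hcon.1 hcon.2.1 hcon.2.2).1
  -- If `b = v`, three colors may be missing but two edges have been removed; otherwise two colors
  -- and one edge. Both give degree at least `Δ`.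
  have hb4 : 4 ≤ G.numNeighbors b := by
    by_cases hbv : b = v
    · have h1 := numNeighbors_core_of_common hxy h.adj_b (hbv ▸ h.adj_v)
      have h2 := numNeighbors_ge_of_missing hc ht.eq_b
      omega
    · have h2 := numNeighbors_ge_of_missing_two hc (z := b) (α := r) (β := z) fun δ hδ => by
        rcases ht.eq_b δ hδ with e | rfl | e
        exacts [Or.inl e, absurd hδ (ht.not_mem_b hbv), Or.inr e]
      omega
  have hv4 : 4 ≤ G.numNeighbors v := by
    by_cases hbv : b = v
    · exact hbv ▸ hb4
    · have h2 := numNeighbors_ge_of_missing_two hc (z := v) (α := t) (β := z) fun δ hδ => by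
        rcases ht.eq_v δ hδ with rfl | e | e
        exacts [absurd hδ (ht.not_mem_v hbv), Or.inl e, Or.inr e]
      omega
  obtain ⟨p, p', hpp', ⟨pr, pt, pz⟩, pr', pt', pz'⟩ := exists_two_ne hΔ r t z
  have hrel : ∀ ρ, ρ = p ∨ ρ = p' → ((G.core x y).twoColored c r ρ).Reachable a b ∧
      ((G.core x y).twoColored c t ρ).Reachable a v := by
    rintro ρ (rfl | rfl)
    exacts [ht.rel _ pr pt pz, ht.rel _ pr' pt' pz']
  obtain ⟨c', v₁, v₂, hex, rfl, rfl, hne⟩ := hG.exists_exchange (core_le G x y) hc har hat ht.rt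
    hpp' (by omega) (by
      rintro β (rfl | rfl) ρ hρ
      · exact ⟨b, h.ab, by omega, (hrel ρ hρ).1⟩
      · exact ⟨v, h.uv, by omega, (hrel ρ hρ).2⟩)
  have g1 := hex.isGood pz.symm pz'.symm pr.symm pr'.symm
    (hK.isGood h.ab haz ht.mem_b ht.zr (Or.inl har))
  have g2 := hex.isGood pr.symm pr'.symm pt.symm pt'.symm
    (hK.isGood h.uv har ht.mem_v ht.rt (Or.inl hat))
  have h1 := (h.isBlocked hcol (hex.valid hc)).rel_right_left (isKempe (hex.valid hc)) g1 g2 ht.zt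
    pz pr pt
  rw [twoColored_comm] at h1
  refine hex.not_reachable hc har h.ab.symm (hne b hb4).2 (hc.isEnd_right ht.mem_b _) ?_ h1.symm
  rw [twoColored_comm]
  exact (hrel _ (Or.inl rfl)).1

theorem exists_valid (h : IsLink G x y a b u v) (hG : G.IsReducible Δ) (hΔ : 4 ≤ Δ)
    (ih : ∃ c : Sym2 V → Fin (Δ + 1), (G.deleteEdges {s(x, y)}).Valid c) :
    ∃ c : Sym2 V → Fin (Δ + 1), G.Valid c := by
  obtain ⟨c, hc⟩ := ih
  by_contra hcol
  push Not at hcol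
  by_cases au : a = u
  · subst au
    exact h.false_of_common hG hΔ hcol hc
  by_cases av : a = v
  · subst av
    exact h.swap_right.false_of_common hG hΔ hcol hc
  by_cases bu : b = u
  · subst bu
    exact h.swap_left.false_of_common hG hΔ hcol hc
  by_cases bv : b = v
  · subst bv
    exact h.swap_left.swap_right.false_of_common hG hΔ hcol hc
  exact h.false_of_distinct hG hΔ hcol au av bu bv hc

end IsLink

/-! ### The induction, and the passage from connected graphs -/

section Main

variable {V : Type*} [Finite V] {G : SimpleGraph V} {Δ : ℕ}

theorem exists_isLink {x y : V} (hxy : G.Adj x y) (hx : G.numNeighbors x = 3)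
    (hy : G.numNeighbors y = 3) : ∃ a b u v, IsLink G x y a b u v := by
  have key : ∀ {x y : V}, G.Adj x y → G.numNeighbors x = 3 →
      ∃ a b, a ≠ b ∧ a ≠ y ∧ b ≠ y ∧ ∀ w, G.Adj x w ↔ w = y ∨ w = a ∨ w = b := by
    intro x y hxy hx
    have h1 : (G.neighborSet x \ {y}).ncard = 2 := by
      have := Set.ncard_sdiff_singleton_add_one (s := G.neighborSet x) hxy
      rw [numNeighbors] at hx
      omega
    obtain ⟨a, b, hab, h2⟩ := Set.ncard_eq_two.1 h1
    have h3 : ∀ w, (G.Adj x w ∧ w ≠ y) ↔ w = a ∨ w = b := fun w => by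
      have : w ∈ G.neighborSet x \ {y} ↔ w ∈ ({a, b} : Set V) := by rw [h2]
      simpa using this
    refine ⟨a, b, hab, ((h3 a).2 (Or.inl rfl)).2, ((h3 b).2 (Or.inr rfl)).2, fun w => ?_⟩
    rw [← h3]
    by_cases hw : w = y
    · simp [hw, hxy]
    · simp [hw]
  obtain ⟨a, b, h1, h2, h3, h4⟩ := key hxy hx
  obtain ⟨u, v, k1, k2, k3, k4⟩ := key hxy.symm hy
  exact ⟨a, b, u, v, h4, k4, h1, k1, h2, h3, k2, k3⟩

theorem IsReducible.exists_valid (hG : G.IsReducible Δ) :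
    ∃ c : Sym2 V → Fin (Δ + 1), G.Valid c := by
  induction G using WellFoundedLT.induction with
  | ind G ih =>
    have hiso : ∀ {x y}, G.Adj x y → ∃ c : Sym2 V → Fin (Δ + 1), (G.isolate x).Valid c := by
      intro x y hxy
      refine ih _ (lt_of_le_of_ne (G.isolate_le x) fun e => ?_) (hG.mono (G.isolate_le x))
      rw [← e] at hxy
      exact hxy.2.1 rfl
    have hsmall : (∃ x, 1 ≤ G.numNeighbors x ∧ G.numNeighbors x ≤ 2) →
        ∃ c : Sym2 V → Fin (Δ + 1), G.Valid c := by
      rintro ⟨x, hx1, hx2⟩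
      obtain ⟨y, hy⟩ := (Set.ncard_pos (s := G.neighborSet x)).1 hx1
      rcases (show G.numNeighbors x = 1 ∨ G.numNeighbors x = 2 by omega) with hx | hx
      · exact exists_valid_of_numNeighbors_eq_one hG.le hx (hiso hy)
      · exact hG.exists_valid_of_numNeighbors_eq_two hx (hiso hy)
    have hmedium : (∃ x, 4 ≤ G.numNeighbors x ∧ G.numNeighbors x < Δ) →
        ∃ c : Sym2 V → Fin (Δ + 1), G.Valid c := by
      rintro ⟨x, hx1, hx2⟩
      obtain ⟨y, hy⟩ := (Set.ncard_pos (s := G.neighborSet x)).1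
        (show 0 < G.numNeighbors x by omega)
      exact exists_valid_of_numNeighbors_lt hx1 hx2
        (fun v hv => (hG.sparse x v hv).resolve_left (by omega)) (hiso hy)
    by_cases h0 : G = ⊥
    · subst h0
      exact ⟨fun _ => 0, fun _ _ _ h => absurd h id,
        fun _ _ _ => isAcyclic_bot.anti fun _ _ h => h.1⟩
    obtain ⟨x, y, hxy, hsum⟩ := hG.exists_light G le_rfl h0
    by_contra hcon
    have hx1 := numNeighbors_pos hxy
    have hy1 := numNeighbors_pos hxy.symm
    have hs := fun z (h : 1 ≤ G.numNeighbors z ∧ G.numNeighbors z ≤ 2) => hcon (hsmall ⟨z, h⟩)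
    have hm := fun z (h : 4 ≤ G.numNeighbors z ∧ G.numNeighbors z < Δ) => hcon (hmedium ⟨z, h⟩)
    have h3 : ∀ z, 0 < G.numNeighbors z → 3 ≤ G.numNeighbors z := fun z hz => by
      by_contra h
      exact hs z ⟨hz, by omega⟩
    have h4 : ∀ z, 4 ≤ G.numNeighbors z → Δ ≤ G.numNeighbors z := fun z hz => by
      by_contra h
      exact hm z ⟨hz, by omega⟩
    have hx3 := h3 x hx1
    have hy3 := h3 y hy1
    -- A degree of at least `Δ` at one end and 3 at the other would exceed `Δ + 2`. With both
    -- degrees equal to 3, lightness also gives `Δ ≥ 4`.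
    have hx : G.numNeighbors x = 3 := by
      by_contra h
      have := h4 x (by omega)
      omega
    have hy : G.numNeighbors y = 3 := by
      by_contra h
      have := h4 y (by omega)
      omega
    obtain ⟨a, b, u, v, hlink⟩ := exists_isLink hxy hx hy
    refine hcon (hlink.exists_valid hG (by omega) (ih _ (lt_of_le_of_ne (deleteEdges_le _)
      fun e => ?_) (hG.mono (deleteEdges_le _))))
    rw [← e, deleteEdges_adj] at hxy
    exact hxy.2 rfl

theorem Connected.isReducible (hconn : G.Connected) (hle : ∀ v, G.numNeighbors v ≤ Δ)
    (hsparse : ∀ u v, G.Adj u v → G.numNeighbors u ≤ 3 ∨ G.numNeighbors v ≤ 3)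
    (hedge : ∃ x y, G.Adj x y ∧ G.numNeighbors x + G.numNeighbors y ≤ Δ + 2) :
    G.IsReducible Δ := by
  refine ⟨hle, hsparse, fun K hK hne => ?_⟩
  by_contra hcon
  push Not at hcon
  -- The degree sum of an edge of `K` is at least `Δ + 3` in `K` and at most `Δ + 3` in `G`, so no
  -- edge at its ends is lost.
  have heq : ∀ u v, K.Adj u v → K.neighborSet u = G.neighborSet u := by
    intro u v huv
    refine Set.eq_of_subset_of_ncard_le (fun w hw => hK hw) ?_ (Set.toFinite _)
    have h1 := hcon u v huv
    have h2 := numNeighbors_mono hK u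
    have h3 := numNeighbors_mono hK v
    have h4 := hle u
    have h5 := hle v
    change G.numNeighbors u ≤ K.numNeighbors u
    rcases hsparse u v (hK huv) with h | h <;> omega
  obtain ⟨u, v, huv⟩ := ne_bot_iff_exists_adj.1 hne
  have hall : ∀ w, ∃ w', K.Adj w w' := by
    intro w
    have hr := (reachable_iff_reflTransGen _ _).1 (hconn.preconnected u w)
    induction hr with
    | refl => exact ⟨v, huv⟩
    | @tail s t _ hst ih =>
      obtain ⟨s', hs'⟩ := ih
      have : t ∈ K.neighborSet s := by rw [heq s s' hs']; exact hst
      exact ⟨s, (this : K.Adj s t).symm⟩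
  obtain ⟨x, y, hxy, hsum⟩ := hedge
  obtain ⟨x', hx'⟩ := hall x
  have hxy' : K.Adj x y := by
    have : y ∈ K.neighborSet x := by rw [heq x x' hx']; exact hxy
    exact this
  have h1 := hcon x y hxy'
  have h2 := numNeighbors_mono hK x
  have h3 := numNeighbors_mono hK y
  omega

end Main

/-! ### Translation to edge colorings of the line graph -/

theorem Valid.acyclicEdgeColorable {V : Type*} {G : SimpleGraph V} {k : ℕ} {c : Sym2 V → Fin k}
    (hc : G.Valid c) : G.AcyclicEdgeColorable k := by
  refine ⟨Coloring.mk (fun e => c e) ?_, ?_⟩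
  · rintro ⟨e, he⟩ ⟨f, hf⟩ hef hcol
    rw [lineGraph_adj_iff_exists] at hef
    obtain ⟨hne, w, hwe, hwf⟩ := hef
    obtain ⟨s, rfl⟩ := Sym2.mem_iff_exists.1 hwe
    obtain ⟨t, rfl⟩ := Sym2.mem_iff_exists.1 hwf
    have := hc.proper (u := w) he hf hcol
    subst this
    exact hne rfl
  · intro v p hp hbi
    obtain ⟨α, β, hαβ, hset⟩ := Set.ncard_eq_two.1 hbi
    have hedge : ∀ e ∈ p.edges, e ∈ (G.twoColored c α β).edgeSet := by
      intro e he
      have heG := p.edges_subset_edgeSet he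
      have hmem : c e ∈ ({α, β} : Set (Fin k)) := hset ▸ ⟨⟨e, heG⟩, he, rfl⟩
      induction e with
      | _ s t => exact ⟨heG, hmem⟩
    exact hc.acyclic hαβ _ (hp.transfer hedge)

end SimpleGraph

theorem theorem1 {V : Type*} [Fintype V] (G : SimpleGraph V) [DecidableRel G.Adj]
    (hconn : G.Connected) (hsparse : G.IsSparse 3)
    (hedge : ∃ x y : V, G.Adj x y ∧ G.degree x + G.degree y < G.maxDegree + 3) :
    G.AcyclicEdgeColorable (G.maxDegree + 1) ∧
      G.acyclicChromaticIndex ≤ ((G.maxDegree + 1 : ℕ) : ℕ∞) := by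
  have hdeg : ∀ v, G.numNeighbors v = G.degree v := fun v => by
    rw [SimpleGraph.numNeighbors, Set.ncard_eq_toFinset_card']
    rfl
  have hred : G.IsReducible G.maxDegree := by
    refine hconn.isReducible (fun v => ?_) (fun u v huv => ?_) ?_
    · rw [hdeg]; exact G.degree_le_maxDegree v
    · rw [hdeg, hdeg]; exact hsparse huv
    · obtain ⟨x, y, hxy, hlt⟩ := hedge
      exact ⟨x, y, hxy, by rw [hdeg, hdeg]; omega⟩
  obtain ⟨c, hc⟩ := hred.exists_valid
  exact ⟨hc.acyclicEdgeColorable, iInf₂_le _ hc.acyclicEdgeColorable⟩
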